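/- **Error function for the scalar Gaussian case.** Let $\hbar>0$, $n\ge 1$, and let $\mathcal H$ be a Hilbert space carrying the irreducible (Weyl) representation of the canonical commutation relations with position $\vec Q=(Q_1,\dots,Q_n)$ and momentum $\vec P=(P_1,\dots,P_n)$, brought by a unitary $U:\mathcal H\to L^2(\mathbb R^n)$ into Schrödinger form ($Q_j$ is multiplication by the $j$-th coordinate, $P_j=-i\hbar\,\partial_j$). Let $W(\vec x,\vec p)=\exp\{\frac i\hbar(\vec p\cdot\vec Q-\vec x\cdot\vec P)\}$ be the Weyl operators and $\Omega=\begin{pmatrix}0&\hbar 1\\-\hbar 1&0\end{pmatrix}$. Let $\vec u,\vec v\in\mathbb R^n$ be unit vectors, and let $\mathsf Q_{\vec u,\rho}$, $\mathsf P_{\vec v,\rho}$ be the distributions in a state $\rho$ of $\vec u\cdot\vec Q$ and $\vec v\cdot\vec P$, i.e. $A\mapsto\mathrm{Tr}\{\rho\,E(A)\}$ with $E$ the respective spectral measure. A state $\rho$ is *Gaussian* with parameters $\mu^\rho\in\mathbb R^{2n}$ and $V^\rho=\begin{pmatrix}A^\rho&C^\rho\\(C^\rho)^T&B^\rho\end{pmatrix}$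 real, $V^\rho+\frac i2\Omega\ge0$, if $\mathrm{Tr}\{\rho\,W(-\Omega w)\}=\exp\{i\,w^T\mu^\rho-\frac12 w^TV^\rho w\}$ for all $w\in\mathbb R^{2n}$. A POVM $\mathsf M$ on $\mathbb R^2$ is *$(\vec u,\vec v)$-covariant* if $W(\vec x,\vec p)\mathsf M(Z)W(\vec x,\vec p)^*=\mathsf M\big(Z+(\vec u\cdot\vec x,\vec v\cdot\vec p)\big)$ for all Borel $Z$ and all $\vec x,\vec p\in\mathbb R^n$. It is *Gaussian* with parameters $\mu^{\mathsf M}=(a^{\mathsf M},b^{\mathsf M})\in\mathbb R^2$, $V^{\mathsf M}$ a real symmetric $2\times2$ matrix and $J^{\mathsf M}$ a real $2\times 2n$ matrix, with $V^{\mathsf M}\pm\frac i2J^{\mathsf M}\Omega(J^{\mathsf M})^T\ge0$, if $$\int_{\mathbb R^2} e^{i\kappa\cdot z}\,\mathsf M(dz)=W\big(-\Omega (J^{\mathsf M})^T\kappa\big)\,\exp\{i\,\kappa\cdot\mu^{\mathsf M}-\tfrac12\,\kappa\cdot V^{\mathsf M}\kappa\}\qquad\forall\kappa\in\mathbb R^2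 .$$ Let $\mathsf M_1,\mathsf M_2$ be the marginals of $\mathsf M$ and $\mathsf M_{1,\rho},\mathsf M_{2,\rho}$ their distributions in the state $\rho$. The *error function* is $$S(\rho,\mathsf M)=S(\mathsf Q_{\vec u,\rho}\,\|\,\mathsf M_{1,\rho})+S(\mathsf P_{\vec v,\rho}\,\|\,\mathsf M_{2,\rho})\in[0,+\infty],$$ where $S(p\|q)=\int\log\frac{dp}{dq}\,dp$ is the relative entropy and $\log=\log_2$. Then for every Gaussian state $\rho$ and every Gaussian $(\vec u,\vec v)$-covariant POVM $\mathsf M$ on $\mathbb R^2$ with parameters as above, $S(\rho,\mathsf M)$ is finite and $$S(\rho,\mathsf M)=\frac{\log e}{2}\,\big[s(x)+s(y)+\Delta(\rho,\mathsf M)\big],$$ where $$x=\frac{V^{\mathsf M}_{11}}{\mathrm{Var}(\mathsf Q_{\vec u,\rho})}\ge0,\qquad y=\frac{V^{\mathsf M}_{22}}{\mathrm{Var}(\mathsf P_{\vec v,\rho})}\ge0,\qquad \Delta(\rho,\mathsf M)=\frac{(a^{\mathsf M})^2}{\mathrm{Var}(\mathsf M_{1,\rho})}+\frac{(b^{\mathsf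 M})^2}{\mathrm{Var}(\mathsf M_{2,\rho})},$$ $$\mathrm{Var}(\mathsf Q_{\vec u,\rho})=\vec u\cdot A^\rho\vec u>0,\quad \mathrm{Var}(\mathsf P_{\vec v,\rho})=\vec v\cdot B^\rho\vec v>0,\quad \mathrm{Var}(\mathsf M_{1,\rho})=\mathrm{Var}(\mathsf Q_{\vec u,\rho})+V^{\mathsf M}_{11},\quad \mathrm{Var}(\mathsf M_{2,\rho})=\mathrm{Var}(\mathsf P_{\vec v,\rho})+V^{\mathsf M}_{22},$$ and $$s(x)=\ln(1+x)-\frac{x}{1+x}$$ is a $C^\infty$ strictly increasing function $[0,+\infty)\to[0,+\infty)$ with $s(0)=0$. In particular $S(\rho,\mathsf M)$ does not depend on the mixed covariances: if $\rho,\rho'$ are Gaussian states with $A^\rho=A^{\rho'}$ and $B^\rho=B^{\rho'}$, and $\mathsf M,\mathsf M'$ are Gaussian $(\vec u,\vec v)$-covariant POVMs with $\mu^{\mathsf M}=\mu^{\mathsf M'}$, $V^{\mathsf M}_{11}=V^{\mathsf M'}_{11}$ and $V^{\mathsf M}_{22}=V^{\mathsf M'}_{22}$, then $S(\rho,\mathsf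 M)=S(\rho',\mathsf M')$. -/

import Mathlib

open MeasureTheory ProbabilityTheory InformationTheory
open scoped ENNReal ComplexOrder

noncomputable section

namespace EntropicMUR

/-! ### Trace, states, positive operator valued measures -/

section Abstract

variable {H : Type*} [NormedAddCommGroup H] [InnerProductSpace ℂ H] [CompleteSpace H]

/-- The index set of a fixed Hilbert basis of `H`. -/
def basisIndex (H : Type*) [NormedAddCommGroup H] [InnerProductSpace ℂ H] [CompleteSpace H] :
    Set H :=
  (exists_hilbertBasis ℂ H).choose

/-- A fixed Hilbert basis of `H`, used to compute traces (the trace of a trace class operator does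
not depend on it). -/
def stdBasis (H : Type*) [NormedAddCommGroup H] [InnerProductSpace ℂ H] [CompleteSpace H] :
    HilbertBasis (basisIndex H) ℂ H :=
  (exists_hilbertBasis ℂ H).choose_spec.choose

/-- The trace `Tr T = ∑ᵢ ⟨eᵢ, T eᵢ⟩`. -/
def tr (T : H →L[ℂ] H) : ℂ := ∑' i, inner ℂ (stdBasis H i) (T (stdBasis H i))

/-- States (statistical operators): positive trace class operators with unit trace.
A positive operator is trace class iff its diagonal in a Hilbert basis is summable. -/
structure State (H : Type*) [NormedAddCommGroup H] [InnerProductSpace ℂ H] [CompleteSpace H] where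
  op : H →L[ℂ] H
  isPositive : op.IsPositive
  hasSum_one : HasSum (fun i => inner ℂ (stdBasis H i) (op (stdBasis H i))) 1

/-- Positive operator valued measures on `Ω`, weakly countably additive and normalized
(only the values on measurable sets are meaningful). -/
structure POVM (Ω : Type*) [MeasurableSpace Ω]
    (H : Type*) [NormedAddCommGroup H] [InnerProductSpace ℂ H] [CompleteSpace H] where
  op : Set Ω → H →L[ℂ] H
  isPositive : ∀ A, MeasurableSet A → (op A).IsPositive
  op_univ : op Set.univ = 1
  hasSum_iUnion : ∀ A : ℕ → Set Ω, (∀ i, MeasurableSet (A i)) → Pairwise (Function.onFun Disjoint A) →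
    ∀ φ ψ : H, HasSum (fun i => inner ℂ φ (op (A i) ψ)) (inner ℂ φ (op (⋃ i, A i) ψ))

lemma hasSum_normSq_inner (x : H) :
    HasSum (fun i => ‖inner ℂ (stdBasis H i) x‖ ^ 2) (‖x‖ ^ 2) := by
  have h := ((stdBasis H).hasSum_inner_mul_inner x x).mapL Complex.reCLM
  have h1 : Complex.reCLM (inner ℂ x x) = ‖x‖ ^ 2 := inner_self_eq_norm_sq (𝕜 := ℂ) x
  rw [h1] at h
  convert h using 1
  funext i
  have h2 := inner_mul_symm_re_eq_norm (𝕜 := ℂ) x (stdBasis H i)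
  rw [norm_mul, norm_inner_symm x, ← sq] at h2
  exact h2.symm

lemma summable_normSq_double {R : H →L[ℂ] H}
    (hR : Summable fun j => ‖R (stdBasis H j)‖ ^ 2) :
    Summable fun z : basisIndex H × basisIndex H =>
      ‖inner ℂ (stdBasis H z.2) (R (stdBasis H z.1))‖ ^ 2 := by
  refine (summable_prod_of_nonneg (fun z => sq_nonneg _)).2
    ⟨fun j => (hasSum_normSq_inner (R (stdBasis H j))).summable, ?_⟩
  exact hR.congr fun j => (hasSum_normSq_inner (R (stdBasis H j))).tsum_eq.symm

/-- `Tr (R² T) = ∑ᵢ ⟨R eᵢ, T R eᵢ⟩` for a self-adjoint Hilbert-Schmidt operator `R`. -/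
lemma hasSum_tr_sq_comp {R : H →L[ℂ] H} (hsa : ∀ x y, inner ℂ (R x) y = inner ℂ x (R y))
    (hR : Summable fun j => ‖R (stdBasis H j)‖ ^ 2) (T : H →L[ℂ] H) :
    HasSum (fun i => inner ℂ (R (stdBasis H i)) (T (R (stdBasis H i)))) (tr ((R * R) ∘L T)) := by
  set e := stdBasis H
  set S : H →L[ℂ] H := (ContinuousLinearMap.adjoint T) ∘L R
  have hS : Summable fun j => ‖S (e j)‖ ^ 2 := by
    refine Summable.of_nonneg_of_le (fun _ => by positivity) (fun j => ?_)
      (hR.mul_left (‖ContinuousLinearMap.adjoint T‖ ^ 2))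
    rw [← mul_pow]
    gcongr
    exact (ContinuousLinearMap.adjoint T).le_opNorm (R (e j))
  have h1 := summable_normSq_double hR
  have h2 := summable_normSq_double hS
  let F : basisIndex H → basisIndex H → ℂ := fun j i =>
    inner ℂ (S (e j)) (e i) * inner ℂ (e i) (R (e j))
  have hF : Summable (Function.uncurry F) := by
    refine Summable.of_norm_bounded (h1.add h2) fun z => ?_
    simp only [Function.uncurry, F, norm_mul]
    rw [norm_inner_symm (S (e z.1))]
    nlinarith [sq_nonneg (‖inner ℂ (e z.2) (S (e z.1))‖ - ‖inner ℂ (e z.2) (R (e z.1))‖),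
      sq_nonneg ‖inner ℂ (e z.2) (S (e z.1))‖, sq_nonneg ‖inner ℂ (e z.2) (R (e z.1))‖]
  have hrow : ∀ j, ∑' i, F j i = inner ℂ (R (e j)) (T (R (e j))) := fun j => by
    rw [← ContinuousLinearMap.adjoint_inner_left]
    exact e.tsum_inner_mul_inner _ _
  have hcol : ∀ i, ∑' j, F j i = inner ℂ (e i) (((R * R) ∘L T) (e i)) := fun i => by
    have : inner ℂ (e i) (((R * R) ∘L T) (e i)) = inner ℂ (R (e i)) (R (T (e i))) := by
      rw [hsa]; rfl
    rw [this, ← e.tsum_inner_mul_inner]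
    refine tsum_congr fun j => ?_
    simp only [F, S, ContinuousLinearMap.comp_apply, ContinuousLinearMap.adjoint_inner_left]
    rw [mul_comm, hsa (e j), ← hsa (e i)]
  have hsum : Summable fun j => inner ℂ (R (e j)) (T (R (e j))) := by
    have h := hF.prod
    have h3 : (fun j => inner ℂ (R (e j)) (T (R (e j)))) =
        fun j => ∑' i, Function.uncurry F (j, i) := funext fun j => (hrow j).symm
    rw [h3]
    exact h
  have : ∑' j, inner ℂ (R (e j)) (T (R (e j))) = tr ((R * R) ∘L T) := by
    calc ∑' j, inner ℂ (R (e j)) (T (R (e j))) = ∑' j, ∑' i, F j i :=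
          tsum_congr fun j => (hrow j).symm
      _ = ∑' i, ∑' j, F j i := hF.tsum_comm.symm
      _ = tr ((R * R) ∘L T) := tsum_congr hcol
  exact this ▸ hsum.hasSum

lemma State.hasSum_tr (ρ : State H) (T : H →L[ℂ] H) :
    HasSum (fun i => inner ℂ (CFC.sqrt ρ.op (stdBasis H i)) (T (CFC.sqrt ρ.op (stdBasis H i))))
      (tr (ρ.op ∘L T)) := by
  have h0 : 0 ≤ ρ.op := (ContinuousLinearMap.nonneg_iff_isPositive _).2 ρ.isPositive
  have hR : CFC.sqrt ρ.op * CFC.sqrt ρ.op = ρ.op := CFC.sqrt_mul_sqrt_self _ h0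
  have hsa : ∀ x y, inner ℂ (CFC.sqrt ρ.op x) y = inner ℂ x (CFC.sqrt ρ.op y) :=
    ((ContinuousLinearMap.nonneg_iff_isPositive _).1 (CFC.sqrt_nonneg ρ.op)).isSymmetric
  have hs : Summable fun j => ‖CFC.sqrt ρ.op (stdBasis H j)‖ ^ 2 := by
    have h := ρ.hasSum_one.summable.mapL Complex.reCLM
    refine h.congr fun j => ?_
    have h1 : ρ.op (stdBasis H j) = CFC.sqrt ρ.op (CFC.sqrt ρ.op (stdBasis H j)) := by
      conv_lhs => rw [← hR]
      rfl
    rw [h1, ← hsa]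
    exact (inner_self_eq_norm_sq (𝕜 := ℂ) (CFC.sqrt ρ.op (stdBasis H j)))
  have := hasSum_tr_sq_comp hsa hs T
  rwa [hR] at this

lemma POVM.op_empty {Ω : Type*} [MeasurableSpace Ω] (E : POVM Ω H) : E.op ∅ = 0 := by
  ext ψ
  refine ext_inner_left ℂ fun φ => ?_
  have h := E.hasSum_iUnion (fun _ => ∅) (fun _ => MeasurableSet.empty)
    (fun _ _ _ => by simp [Function.onFun]) φ ψ
  have h2 := h.summable.tendsto_atTop_zero
  simpa using tendsto_nhds_unique tendsto_const_nhds h2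

lemma POVM.diag_iUnion {Ω : Type*} [MeasurableSpace Ω] (E : POVM Ω H) (ψ : H)
    ⦃A : ℕ → Set Ω⦄ (hA : ∀ i, MeasurableSet (A i)) (hd : Pairwise (Function.onFun Disjoint A)) :
    ENNReal.ofReal (inner ℂ ψ (E.op (⋃ i, A i) ψ)).re =
      ∑' i, ENNReal.ofReal (inner ℂ ψ (E.op (A i) ψ)).re := by
  have h := (E.hasSum_iUnion A hA hd ψ ψ).mapL Complex.reCLM
  have h' : HasSum (fun i => (inner ℂ ψ (E.op (A i) ψ)).re)
      (inner ℂ ψ (E.op (⋃ i, A i) ψ)).re := h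
  rw [← h'.tsum_eq, ENNReal.ofReal_tsum_of_nonneg _ h'.summable]
  exact fun i => (E.isPositive _ (hA i)).re_inner_nonneg_right _

/-- The positive measure `A ↦ ⟨ψ, E(A) ψ⟩`. -/
def POVM.diag {Ω : Type*} [MeasurableSpace Ω] (E : POVM Ω H) (ψ : H) : Measure Ω :=
  Measure.ofMeasurable (fun A _ => ENNReal.ofReal (inner ℂ ψ (E.op A ψ)).re)
    (by simp [E.op_empty]) (fun _ hA hd => E.diag_iUnion ψ hA hd)

lemma tr_comp_iUnion {Ω : Type*} [MeasurableSpace Ω] (E : POVM Ω H) (ρ : State H)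
    ⦃A : ℕ → Set Ω⦄ (hA : ∀ i, MeasurableSet (A i)) (hd : Pairwise (Function.onFun Disjoint A)) :
    ENNReal.ofReal (tr (ρ.op ∘L E.op (⋃ i, A i))).re =
      ∑' i, ENNReal.ofReal (tr (ρ.op ∘L E.op (A i))).re := by
  have key : ∀ B, MeasurableSet B → ENNReal.ofReal (tr (ρ.op ∘L E.op B)).re =
      ∑' j, ENNReal.ofReal (inner ℂ (CFC.sqrt ρ.op (stdBasis H j))
        (E.op B (CFC.sqrt ρ.op (stdBasis H j)))).re := by
    intro B hB
    have h := (ρ.hasSum_tr (E.op B)).mapL Complex.reCLM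
    have h' : HasSum (fun j => (inner ℂ (CFC.sqrt ρ.op (stdBasis H j))
        (E.op B (CFC.sqrt ρ.op (stdBasis H j)))).re) (tr (ρ.op ∘L E.op B)).re := h
    rw [← h'.tsum_eq, ENNReal.ofReal_tsum_of_nonneg _ h'.summable]
    exact fun j => (E.isPositive B hB).re_inner_nonneg_right _
  rw [key _ (MeasurableSet.iUnion hA)]
  simp only [fun i => key _ (hA i)]
  rw [ENNReal.tsum_comm]
  refine tsum_congr fun j => ?_
  exact E.diag_iUnion _ hA hd

/-- The distribution `A ↦ Tr {ρ E(A)}` of the observable `E` in the state `ρ`. -/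
def POVM.dist {Ω : Type*} [MeasurableSpace Ω] (E : POVM Ω H) (ρ : State H) : Measure Ω :=
  Measure.ofMeasurable (fun A _ => ENNReal.ofReal (tr (ρ.op ∘L E.op A)).re)
    (by simp [E.op_empty, tr]) (fun _ hA hd => tr_comp_iUnion E ρ hA hd)

/-- The observable `A ↦ E(f⁻¹ A)`; in particular, marginals of an observable. -/
def POVM.map {Ω Ω' : Type*} [MeasurableSpace Ω] [MeasurableSpace Ω'] (E : POVM Ω H)
    (f : Ω → Ω') (hf : Measurable f) : POVM Ω' H where
  op A := E.op (f ⁻¹' A)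
  isPositive A hA := E.isPositive _ (hf hA)
  op_univ := by simpa using E.op_univ
  hasSum_iUnion A hA hd φ ψ := by
    rw [Set.preimage_iUnion]
    exact E.hasSum_iUnion _ (fun i => hf (hA i)) (fun i j h => (hd h).preimage f) φ ψ

/-- The observable `A ↦ U⁻¹ E(A) U` for a unitary `U : H → K`. -/
def POVM.conj {Ω : Type*} [MeasurableSpace Ω] {K : Type*} [NormedAddCommGroup K]
    [InnerProductSpace ℂ K] [CompleteSpace K] (E : POVM Ω K) (U : H ≃ₗᵢ[ℂ] K) : POVM Ω H where
  op A := (U.symm : K →L[ℂ] H) ∘L E.op A ∘L (U : H →L[ℂ] K)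
  isPositive A hA := by
    have h := E.isPositive A hA
    rw [ContinuousLinearMap.isPositive_iff_complex]
    intro x
    have hx : inner ℂ (U.symm (E.op A (U x))) x = inner ℂ (E.op A (U x)) (U x) := by
      conv_lhs => rw [← U.symm_apply_apply x]
      rw [U.symm.inner_map_map, U.apply_symm_apply]
    change ((RCLike.re (inner ℂ (U.symm (E.op A (U x))) x) : ℂ) = inner ℂ (U.symm (E.op A (U x))) x)
      ∧ 0 ≤ RCLike.re (inner ℂ (U.symm (E.op A (U x))) x)
    rw [hx]
    exact (ContinuousLinearMap.isPositive_iff_complex _).1 h (U x)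
  op_univ := by
    ext x
    simp [E.op_univ]
  hasSum_iUnion A hA hd φ ψ := by
    have h := E.hasSum_iUnion A hA hd (U φ) (U ψ)
    have key : ∀ B, inner ℂ φ (((U.symm : K →L[ℂ] H) ∘L E.op B ∘L (U : H →L[ℂ] K)) ψ) =
        inner ℂ (U φ) (E.op B (U ψ)) := fun B => by
      conv_lhs => rw [← U.symm_apply_apply φ]
      exact U.symm.inner_map_map _ _
    simpa only [key] using h

/-- `T = ∫ f dE` in the weak sense, for a complex function `f` and an observable `E`:
`⟨ψ, T ψ⟩ = ∫ f(t) ⟨ψ, E(dt) ψ⟩` for all `ψ` (this determines `T` by polarization). -/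
def POVM.HasIntegral {Ω : Type*} [MeasurableSpace Ω] (E : POVM Ω H) (f : Ω → ℂ)
    (T : H →L[ℂ] H) : Prop :=
  ∀ ψ : H, Integrable f (E.diag ψ) ∧ ∫ t, f t ∂(E.diag ψ) = inner ℂ ψ (T ψ)

end Abstract

/-! ### Position, momentum and Weyl operators -/

section Schroedinger

variable {n : ℕ}

/-- The configuration space `ℝⁿ` with its Euclidean structure. -/
abbrev Config (n : ℕ) := EuclideanSpace ℝ (Fin n)

/-- The Hilbert space `L²(ℝⁿ)`. -/
abbrev L2 (n : ℕ) := Lp ℂ 2 (volume : Measure (Config n))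

open Classical in
/-- Multiplication by an essentially bounded measurable function on `L²(ℝⁿ)`. -/
def mulOp (g : Config n → ℂ) : L2 n →L[ℂ] L2 n :=
  if h : MemLp g ∞ (volume : Measure (Config n)) then
    (ContinuousLinearMap.mul ℂ ℂ).holderL volume ∞ 2 2 h.toLp
  else 0

lemma mulOp_ae {g : Config n → ℂ} (hg : MemLp g ∞ (volume : Measure (Config n))) (ψ : L2 n) :
    mulOp g ψ =ᵐ[volume] fun q => g q * ψ q := by
  rw [mulOp, dif_pos hg]
  have h := (ContinuousLinearMap.mul ℂ ℂ).coeFn_holder (r := 2) hg.toLp ψ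
  filter_upwards [h, hg.coeFn_toLp] with q h1 h2
  simp only [ContinuousLinearMap.holderL_apply_apply]
  rw [h1, h2]
  rfl

lemma inner_mulOp_indicator {B : Set (Config n)} (hB : MeasurableSet B) (φ ψ : L2 n) :
    inner ℂ φ (mulOp (B.indicator 1) ψ) = ∫ q in B, inner ℂ (φ q) (ψ q) := by
  have hm : MemLp (B.indicator (1 : Config n → ℂ)) ∞ (volume : Measure (Config n)) := by
    refine memLp_top_of_bound (measurable_one.indicator hB).aestronglyMeasurable 1 ?_
    filter_upwards with q
    by_cases h : q ∈ B <;> simp [h]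
  rw [L2.inner_def, ← integral_indicator hB]
  refine integral_congr_ae ?_
  filter_upwards [mulOp_ae hm ψ] with q hq
  rw [hq]
  by_cases h : q ∈ B <;> simp [h]

/-- The spectral measure of multiplication by a real function `g` on `L²(ℝⁿ)`:
`A` is sent to multiplication by the indicator function of `g⁻¹ A`. -/
def mulPVM (g : Config n → ℝ) (hg : Measurable g) : POVM ℝ (L2 n) where
  op A := mulOp ((g ⁻¹' A).indicator 1)
  isPositive A hA := by
    rw [ContinuousLinearMap.isPositive_iff_complex]
    intro ψ
    have h : inner ℂ (mulOp ((g ⁻¹' A).indicator 1) ψ) ψ =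
        ((∫ q in g ⁻¹' A, ‖ψ q‖ ^ 2 : ℝ) : ℂ) := by
      rw [← inner_conj_symm, inner_mulOp_indicator (hg hA), ← integral_complex_ofReal,
        ← integral_conj]
      refine integral_congr_ae (Filter.Eventually.of_forall fun q => ?_)
      simp [inner_self_eq_norm_sq_to_K]
    rw [h]
    refine ⟨by simp, ?_⟩
    simp only [RCLike.re_to_complex, Complex.ofReal_re]
    positivity
  op_univ := by
    refine ContinuousLinearMap.ext fun ψ => ext_inner_left ℂ fun φ => ?_
    rw [inner_mulOp_indicator (by simp)]
    simp [L2.inner_def]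
  hasSum_iUnion A hA hd φ ψ := by
    simp only [inner_mulOp_indicator (hg (hA _)), inner_mulOp_indicator (hg (MeasurableSet.iUnion hA))]
    rw [Set.preimage_iUnion]
    exact hasSum_integral_iUnion (fun i => hg (hA i)) (fun i j h => (hd h).preimage g)
      (L2.integrable_inner φ ψ).integrableOn

/-- The Weyl operator `W(x, p) = exp {(i/ħ) (p·Q - x·P)}` on `L²(ℝⁿ)`, with `Q` the multiplication
by the coordinates and `P = -iħ∇`: `(W(x, p) ψ)(q) = exp {(i/ħ) (p·q - p·x/2)} ψ(q - x)`. -/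
def weylL2 (ħ : ℝ) (x p : Config n) : L2 n →L[ℂ] L2 n :=
  mulOp (fun q => Complex.exp (Complex.I * ((inner ℝ p q - inner ℝ p x / 2) / ħ : ℝ))) ∘L
    (Lp.compMeasurePreservingₗᵢ ℂ (fun q : Config n => q - x)
      (measurePreserving_sub_right volume x)).toContinuousLinearMap

variable {H : Type*} [NormedAddCommGroup H] [InnerProductSpace ℂ H] [CompleteSpace H]

/-! In the following `U : H → L²(ℝⁿ)` is the unitary operator which brings the irreducible
representation of the canonical commutation relations on `H` into Schrödinger form. -/

/-- The Weyl operator `W(z)`, `z = (x, p)`, on `H`. -/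
def weyl (ħ : ℝ) (U : H ≃ₗᵢ[ℂ] L2 n) (z : Fin n ⊕ Fin n → ℝ) : H →L[ℂ] H :=
  (U.symm : L2 n →L[ℂ] H) ∘L
    weylL2 ħ (WithLp.toLp 2 fun i => z (Sum.inl i)) (WithLp.toLp 2 fun i => z (Sum.inr i)) ∘L
    (U : H →L[ℂ] L2 n)

/-- The spectral measure of `Q_u = u·Q`. -/
def sharpQ (U : H ≃ₗᵢ[ℂ] L2 n) (u : Config n) : POVM ℝ H :=
  (mulPVM (fun q => inner ℝ u q) (by fun_prop)).conj U

/-- The spectral measure of `P_v = v·P`. With the Fourier transform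
`(𝓕 ψ)(ξ) = ∫ exp(-2πi q·ξ) ψ(q) dq`, the operator `P = -iħ∇` becomes multiplication
by `2πħξ`. -/
def sharpP (ħ : ℝ) (U : H ≃ₗᵢ[ℂ] L2 n) (v : Config n) : POVM ℝ H :=
  (mulPVM (fun ξ => 2 * Real.pi * ħ * inner ℝ v ξ) (by fun_prop)).conj
    (U.trans (Lp.fourierTransformₗᵢ (Config n) ℂ))

/-! ### Gaussian states and Gaussian covariant observables -/

/-- The matrix `Ω = [[0, ħ 1], [-ħ 1, 0]]`. -/
def omega (n : ℕ) (ħ : ℝ) : Matrix (Fin n ⊕ Fin n) (Fin n ⊕ Fin n) ℝ :=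
  Matrix.fromBlocks 0 (ħ • 1) (-(ħ • 1)) 0

/-- The characteristic function of a state, `w ↦ Tr {ρ W(-Ω w)}`. -/
def charState (ħ : ℝ) (U : H ≃ₗᵢ[ℂ] L2 n) (ρ : State H) (w : Fin n ⊕ Fin n → ℝ) : ℂ :=
  tr (ρ.op ∘L weyl ħ U (-((omega n ħ).mulVec w)))

/-- `ρ` is a Gaussian state with parameters `μ = (a, b)` and `V = [[A, C], [Cᵀ, B]]`. -/
def IsGaussianState (ħ : ℝ) (U : H ≃ₗᵢ[ℂ] L2 n) (ρ : State H) (μ : Fin n ⊕ Fin n → ℝ)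
    (V : Matrix (Fin n ⊕ Fin n) (Fin n ⊕ Fin n) ℝ) : Prop :=
  (V.map Complex.ofReal + (Complex.I / 2) • (omega n ħ).map Complex.ofReal).PosSemidef ∧
  ∀ w, charState ħ U ρ w =
    Complex.exp (Complex.I * (w ⬝ᵥ μ : ℝ) - ((w ⬝ᵥ V.mulVec w) / 2 : ℝ))

/-- `M` is a Gaussian bi-observable on `ℝ²` with parameters `(μ, V, J)`; the coordinate `0` of the
outcome is of position type, the coordinate `1` is of momentum type. -/
def IsGaussianObservable (ħ : ℝ) (U : H ≃ₗᵢ[ℂ] L2 n) (M : POVM (Fin 2 → ℝ) H) (μ : Fin 2 → ℝ)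
    (V : Matrix (Fin 2) (Fin 2) ℝ) (J : Matrix (Fin 2) (Fin n ⊕ Fin n) ℝ) : Prop :=
  (V.map Complex.ofReal +
    (Complex.I / 2) • (J * omega n ħ * J.transpose).map Complex.ofReal).PosSemidef ∧
  (V.map Complex.ofReal -
    (Complex.I / 2) • (J * omega n ħ * J.transpose).map Complex.ofReal).PosSemidef ∧
  ∀ k : Fin 2 → ℝ, M.HasIntegral (fun z => Complex.exp (Complex.I * (k ⬝ᵥ z : ℝ)))
    (Complex.exp (Complex.I * (k ⬝ᵥ μ : ℝ) - ((k ⬝ᵥ V.mulVec k) / 2 : ℝ)) •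
      weyl ħ U (-((omega n ħ).mulVec (J.transpose.mulVec k))))

/-- `M` is `(u, v)`-covariant: `W(x, p) M(Z) W(x, p)* = M(Z + (u·x, v·p))`. -/
def IsCovariant (ħ : ℝ) (U : H ≃ₗᵢ[ℂ] L2 n) (u v : Config n) (M : POVM (Fin 2 → ℝ) H) : Prop :=
  ∀ (x p : Fin n → ℝ) (Z : Set (Fin 2 → ℝ)), MeasurableSet Z →
    weyl ħ U (Sum.elim x p) ∘L M.op Z ∘L
        ContinuousLinearMap.adjoint (weyl ħ U (Sum.elim x p)) =
      M.op ((fun z => z + ![u.ofLp ⬝ᵥ x, v.ofLp ⬝ᵥ p]) '' Z)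

/-- The first marginal `M₁(A) = M(A × ℝ)`. -/
def marginal₁ (M : POVM (Fin 2 → ℝ) H) : POVM ℝ H :=
  M.map (fun z => z 0) (measurable_pi_apply 0)

/-- The second marginal `M₂(B) = M(ℝ × B)`. -/
def marginal₂ (M : POVM (Fin 2 → ℝ) H) : POVM ℝ H :=
  M.map (fun z => z 1) (measurable_pi_apply 1)

/-- The relative entropy in bits `S(p‖q) = ∫ log₂ (dp/dq) dp`, equal to `∞` if `p` is not absolutely
continuous with respect to `q` or the integral diverges. -/
def relEntropy (p q : Measure ℝ) : ℝ≥0∞ := klDiv p q / ENNReal.ofReal (Real.log 2)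

/-- The error function `S(ρ, M) = S(Q_{u,ρ}‖M_{1,ρ}) + S(P_{v,ρ}‖M_{2,ρ})`. -/
def errorFunction (ħ : ℝ) (U : H ≃ₗᵢ[ℂ] L2 n) (u v : Config n) (ρ : State H)
    (M : POVM (Fin 2 → ℝ) H) : ℝ≥0∞ :=
  relEntropy ((sharpQ U u).dist ρ) ((marginal₁ M).dist ρ) +
    relEntropy ((sharpP ħ U v).dist ρ) ((marginal₂ M).dist ρ)

end Schroedinger

/-- The function `s(x) = ln (1 + x) - x / (1 + x)`. -/
def sFun (x : ℝ) : ℝ := Real.log (1 + x) - x / (1 + x)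

end EntropicMUR

end

/-! All four distributions are Gaussian on `ℝ`, so the error function is a sum of two explicit
Kullback-Leibler divergences. The operators exp(i t u·Q) and exp(i t v·P) are Weyl operators
(`hasIntegral_sharpQ`, `hasIntegral_sharpP`), so the characteristic functions of the sharp
distributions are those of the state along the vectors (tu, 0) and (0, tv). Covariance and the
commutation relations force Jᵀk = (k₀u, k₁v) (`IsCovariant.transpose_mulVec_eq`). Hence each
marginal has the sharp characteristic function times a Gaussian noise factor: the mean is shifted by
a component of μ and the variance grows by a diagonal entry of V. `POVM.dist_eq_gaussianReal` turns
characteristic functions into measures.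

For variances v and v + c and mean shift a, the divergence in nats is ½[ln((v+c)/v) + (v+a²)/(v+c) -
1] = ½[s(c/v) + a²/(v+c)]. The condition V + iΩ/2 ≥ 0 on the state gives v > 0, which keeps both
Gaussians nondegenerate. Only A, B, V₁₁, V₂₂ and μ of the observable survive, whence the
independence of the mixed covariances. -/

noncomputable section

namespace EntropicMUR

/-! ### Distributions of observables and their integrals in a state -/

section Observables

variable {H : Type*} [NormedAddCommGroup H] [InnerProductSpace ℂ H] [CompleteSpace H]
  {Ω : Type*} [MeasurableSpace Ω]

lemma POVM.diag_apply (E : POVM Ω H) (ψ : H) {A : Set Ω} (hA : MeasurableSet A) :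
    E.diag ψ A = ENNReal.ofReal (inner ℂ ψ (E.op A ψ)).re :=
  Measure.ofMeasurable_apply A hA

lemma POVM.dist_apply (E : POVM Ω H) (ρ : State H) {A : Set Ω} (hA : MeasurableSet A) :
    E.dist ρ A = ENNReal.ofReal (tr (ρ.op ∘L E.op A)).re :=
  Measure.ofMeasurable_apply A hA

/-- The distribution of an observable is a mixture of its distributions in vectors. -/
lemma POVM.dist_eq_sum_diag (E : POVM Ω H) (ρ : State H) :
    E.dist ρ = Measure.sum fun j => E.diag (CFC.sqrt ρ.op (stdBasis H j)) := by
  ext A hA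
  rw [Measure.sum_apply _ hA, E.dist_apply ρ hA]
  simp only [E.diag_apply _ hA]
  have h := (ρ.hasSum_tr (E.op A)).mapL Complex.reCLM
  have h' : HasSum (fun j => (inner ℂ (CFC.sqrt ρ.op (stdBasis H j))
      (E.op A (CFC.sqrt ρ.op (stdBasis H j)))).re) (tr (ρ.op ∘L E.op A)).re := h
  rw [← h'.tsum_eq, ENNReal.ofReal_tsum_of_nonneg _ h'.summable]
  exact fun j => (E.isPositive A hA).re_inner_nonneg_right _

lemma State.tr_eq_one (ρ : State H) : tr ρ.op = 1 := ρ.hasSum_one.tsum_eq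

instance POVM.isProbabilityMeasure_dist (E : POVM Ω H) (ρ : State H) :
    IsProbabilityMeasure (E.dist ρ) := by
  refine ⟨?_⟩
  have h : ρ.op ∘L (1 : H →L[ℂ] H) = ρ.op := by ext; rfl
  rw [E.dist_apply ρ MeasurableSet.univ, E.op_univ, h, ρ.tr_eq_one]
  simp

/-- If `T = ∫ f dE` then the mean of `f` in the state `ρ` is `Tr (ρ T)`. -/
lemma POVM.HasIntegral.integral_dist {E : POVM Ω H} {f : Ω → ℂ} {T : H →L[ℂ] H}
    (h : E.HasIntegral f T) {ρ : State H} (hf : Integrable f (E.dist ρ)) :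
    ∫ t, f t ∂(E.dist ρ) = tr (ρ.op ∘L T) := by
  rw [E.dist_eq_sum_diag ρ] at hf ⊢
  -- Both sides expand over the same vectors √ρ eⱼ. Integrability for each vector separately would
  -- not give summability, so integrability is required for the whole mixture.
  have h1 := hasSum_integral_measure hf
  simp only [(h _).2] at h1
  exact h1.unique (ρ.hasSum_tr T)

lemma POVM.diag_map {Ω' : Type*} [MeasurableSpace Ω'] (E : POVM Ω H) {g : Ω → Ω'}
    (hg : Measurable g) (ψ : H) : (E.map g hg).diag ψ = (E.diag ψ).map g := by
  ext A hA
  rw [POVM.diag_apply _ _ hA, Measure.map_apply hg hA, POVM.diag_apply _ _ (hg hA)]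
  rfl

lemma POVM.HasIntegral.map {Ω' : Type*} [MeasurableSpace Ω'] {E : POVM Ω H} {g : Ω → Ω'}
    (hg : Measurable g) {f : Ω' → ℂ} (hf : Measurable f) {T : H →L[ℂ] H}
    (h : E.HasIntegral (fun t => f (g t)) T) : (E.map g hg).HasIntegral f T := by
  intro ψ
  rw [E.diag_map hg]
  exact ⟨(integrable_map_measure hf.aestronglyMeasurable hg.aemeasurable).2 (h ψ).1,
    (integral_map hg.aemeasurable hf.aestronglyMeasurable).trans (h ψ).2⟩

variable {K : Type*} [NormedAddCommGroup K] [InnerProductSpace ℂ K] [CompleteSpace K]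

lemma inner_symm_comp_comp (U : H ≃ₗᵢ[ℂ] K) (T : K →L[ℂ] K) (φ ψ : H) :
    inner ℂ φ (((U.symm : K →L[ℂ] H) ∘L T ∘L (U : H →L[ℂ] K)) ψ) = inner ℂ (U φ) (T (U ψ)) := by
  conv_lhs => rw [← U.symm_apply_apply φ]
  exact U.symm.inner_map_map _ _

lemma POVM.diag_conj (E : POVM Ω K) (U : H ≃ₗᵢ[ℂ] K) (ψ : H) :
    (E.conj U).diag ψ = E.diag (U ψ) := by
  ext A hA
  rw [POVM.diag_apply _ _ hA, POVM.diag_apply _ _ hA, ← inner_symm_comp_comp U]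
  rfl

lemma POVM.HasIntegral.conj {E : POVM Ω K} {f : Ω → ℂ} {T : K →L[ℂ] K}
    (h : E.HasIntegral f T) (U : H ≃ₗᵢ[ℂ] K) :
    (E.conj U).HasIntegral f ((U.symm : K →L[ℂ] H) ∘L T ∘L (U : H →L[ℂ] K)) := by
  intro ψ
  rw [E.diag_conj, inner_symm_comp_comp]
  exact h (U ψ)

end Observables

/-! ### Relative entropy of Gaussian measures on the line -/

section RelativeEntropy

open scoped NNReal

lemma integrable_sub_sq_gaussianReal (m c : ℝ) (v : ℝ≥0) :
    Integrable (fun x => (x - c) ^ 2) (gaussianReal m v) :=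
  ((memLp_id_gaussianReal (μ := m) (v := v) 2).sub (memLp_const c)).integrable_sq

lemma integral_sub_sq_gaussianReal (m c : ℝ) (v : ℝ≥0) :
    ∫ x, (x - c) ^ 2 ∂(gaussianReal m v) = v + (m - c) ^ 2 := by
  have hi : Integrable (fun x : ℝ => x) (gaussianReal m v) :=
    memLp_one_iff_integrable.1 (memLp_id_gaussianReal 1)
  have h1 : ∫ x, (x - m) ^ 2 ∂(gaussianReal m v) = v := by
    have h := variance_eq_integral (μ := gaussianReal m v) (X := id) aemeasurable_id
    rw [variance_id_gaussianReal] at h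
    simpa [integral_id_gaussianReal] using h.symm
  have h2 : ∫ x, (x - m) ∂(gaussianReal m v) = 0 := by
    rw [integral_sub hi (integrable_const m), integral_id_gaussianReal]
    simp
  have h3 : ∀ x : ℝ, (x - c) ^ 2 = (x - m) ^ 2 + 2 * (m - c) * (x - m) + (m - c) ^ 2 :=
    fun x => by ring
  have h4 : Integrable (fun x => 2 * (m - c) * (x - m)) (gaussianReal m v) :=
    (hi.sub (integrable_const m)).const_mul _
  have h5 : Integrable (fun x => (x - m) ^ 2 + 2 * (m - c) * (x - m)) (gaussianReal m v) :=
    (integrable_sub_sq_gaussianReal m m v).add h4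
  rw [funext h3, integral_add h5 (integrable_const _),
    integral_add (integrable_sub_sq_gaussianReal m m v) h4, integral_const_mul, h1, h2]
  simp

variable {m₁ m₂ : ℝ} {v₁ v₂ : ℝ≥0}

lemma gaussianReal_absolutelyContinuous_gaussianReal (h₁ : v₁ ≠ 0) (h₂ : v₂ ≠ 0) :
    gaussianReal m₁ v₁ ≪ gaussianReal m₂ v₂ :=
  (gaussianReal_absolutelyContinuous m₁ h₁).trans (gaussianReal_absolutelyContinuous' m₂ h₂)

lemma log_gaussianPDFReal (m : ℝ) {v : ℝ≥0} (hv : v ≠ 0) (x : ℝ) :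
    Real.log (gaussianPDFReal m v x) =
      -(Real.log (2 * Real.pi) + Real.log v) / 2 - (x - m) ^ 2 / (2 * v) := by
  have hv' : (0 : ℝ) < v := by positivity
  have hp := Real.pi_pos
  rw [gaussianPDFReal, Real.log_mul (by positivity) (Real.exp_ne_zero _), Real.log_exp,
    Real.log_inv, Real.log_sqrt (by positivity), Real.log_mul (by positivity) hv'.ne']
  ring

lemma llr_gaussianReal (h₁ : v₁ ≠ 0) (h₂ : v₂ ≠ 0) :
    llr (gaussianReal m₁ v₁) (gaussianReal m₂ v₂) =ᵐ[gaussianReal m₁ v₁] fun x =>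
      Real.log (v₂ / v₁) / 2 + (x - m₂) ^ 2 / (2 * v₂) - (x - m₁) ^ 2 / (2 * v₁) := by
  have hac := gaussianReal_absolutelyContinuous m₁ h₁
  have h := Measure.rnDeriv_eq_div hac
    (gaussianReal_absolutelyContinuous m₂ h₂)
  -- The quotient formula holds almost everywhere for the second Gaussian and the density formulas
  -- for Lebesgue measure; absolute continuity carries all three over to the first Gaussian.
  filter_upwards [gaussianReal_absolutelyContinuous_gaussianReal h₁ h₂ h,
    hac (rnDeriv_gaussianReal m₁ v₁), hac (rnDeriv_gaussianReal m₂ v₂)] with x hx hx₁ hx₂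
  have hv₁ : (v₁ : ℝ) ≠ 0 := by exact_mod_cast h₁
  have hv₂ : (v₂ : ℝ) ≠ 0 := by exact_mod_cast h₂
  rw [llr, hx, hx₁, hx₂, ENNReal.toReal_div, toReal_gaussianPDF, toReal_gaussianPDF,
    Real.log_div (gaussianPDFReal_pos _ _ _ h₁).ne' (gaussianPDFReal_pos _ _ _ h₂).ne',
    log_gaussianPDFReal _ h₁, log_gaussianPDFReal _ h₂, Real.log_div hv₂ hv₁]
  ring

lemma integrable_llr_gaussianReal (h₁ : v₁ ≠ 0) (h₂ : v₂ ≠ 0) :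
    Integrable (llr (gaussianReal m₁ v₁) (gaussianReal m₂ v₂)) (gaussianReal m₁ v₁) :=
  (((integrable_const _).add ((integrable_sub_sq_gaussianReal m₁ m₂ v₁).div_const _)).sub
    ((integrable_sub_sq_gaussianReal m₁ m₁ v₁).div_const _)).congr (llr_gaussianReal h₁ h₂).symm

lemma klDiv_gaussianReal_ne_top (h₁ : v₁ ≠ 0) (h₂ : v₂ ≠ 0) :
    klDiv (gaussianReal m₁ v₁) (gaussianReal m₂ v₂) ≠ ∞ :=
  klDiv_ne_top (gaussianReal_absolutelyContinuous_gaussianReal h₁ h₂)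
    (integrable_llr_gaussianReal h₁ h₂)

/-- The Kullback-Leibler divergence of two nondegenerate Gaussian measures. -/
lemma toReal_klDiv_gaussianReal (h₁ : v₁ ≠ 0) (h₂ : v₂ ≠ 0) :
    (klDiv (gaussianReal m₁ v₁) (gaussianReal m₂ v₂)).toReal =
      (Real.log (v₂ / v₁) + (v₁ + (m₁ - m₂) ^ 2) / v₂ - 1) / 2 := by
  have hv₁ : (v₁ : ℝ) ≠ 0 := by exact_mod_cast h₁
  have hv₂ : (v₂ : ℝ) ≠ 0 := by exact_mod_cast h₂
  have i₁ := (integrable_sub_sq_gaussianReal m₁ m₁ v₁).div_const (2 * (v₁ : ℝ))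
  have i₂ := (integrable_sub_sq_gaussianReal m₁ m₂ v₁).div_const (2 * (v₂ : ℝ))
  have i₃ : Integrable (fun x => Real.log (v₂ / v₁) / 2 + (x - m₂) ^ 2 / (2 * v₂))
      (gaussianReal m₁ v₁) := (integrable_const _).add i₂
  -- Both measures have mass one, so the mass correction in `klDiv` vanishes and only the integral
  -- of the log-likelihood ratio remains.
  rw [toReal_klDiv_of_measure_eq (gaussianReal_absolutelyContinuous_gaussianReal h₁ h₂)
    (by simp), integral_congr_ae (llr_gaussianReal h₁ h₂), integral_sub i₃ i₁, integral_add (integrable_const _) i₂,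
    integral_div, integral_div, integral_div, integral_sub_sq_gaussianReal,
    integral_sub_sq_gaussianReal]
  simp
  field_simp

/-- The relative entropy of a Gaussian with respect to its convolution with another Gaussian. -/
lemma relEntropy_gaussianReal (m a : ℝ) {v c : ℝ} (hv : 0 < v) (hc : 0 ≤ c) :
    relEntropy (gaussianReal m v.toNNReal) (gaussianReal (m + a) (v + c).toNNReal) ≠ ∞ ∧
    (relEntropy (gaussianReal m v.toNNReal) (gaussianReal (m + a) (v + c).toNNReal)).toReal =
      Real.logb 2 (Real.exp 1) / 2 * (sFun (c / v) + a ^ 2 / (v + c)) := by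
  have h₁ : v.toNNReal ≠ 0 := by simpa using hv
  have h₂ : (v + c).toNNReal ≠ 0 := by simp; linarith
  have hl : 0 < Real.log 2 := Real.log_pos one_lt_two
  refine ⟨ENNReal.div_ne_top (klDiv_gaussianReal_ne_top h₁ h₂) (by simpa using hl), ?_⟩
  have hvc : 0 < v + c := by linarith
  -- This matches the logarithm in s(c/v); the other term arises from v/(v+c) - 1 = -(c/v)/(1 +
  -- c/v).
  have h3 : 1 + c / v = (v + c) / v := by field_simp
  rw [relEntropy, ENNReal.toReal_div, toReal_klDiv_gaussianReal h₁ h₂, ENNReal.toReal_ofReal hl.le,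
    Real.coe_toNNReal _ hv.le, Real.coe_toNNReal _ hvc.le, sFun, h3, Real.logb, Real.log_exp]
  field_simp
  ring

end RelativeEntropy

/-! ### Properties of the function s -/

section EntropyFunction

lemma sFun_zero : sFun 0 = 0 := by simp [sFun]

lemma contDiffOn_sFun : ContDiffOn ℝ ((⊤ : ℕ∞) : WithTop ℕ∞) sFun (Set.Ici 0) := by
  have h : ∀ x ∈ Set.Ici (0 : ℝ), 1 + x ≠ 0 := fun x hx => by
    have : (0 : ℝ) ≤ x := hx
    positivity
  exact ((contDiffOn_const.add contDiffOn_id).log h).sub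
    (contDiffOn_id.div (contDiffOn_const.add contDiffOn_id) h)

/-- The derivative is x/(1+x)². It vanishes at 0, but positivity in the interior together with
continuity up to the endpoint suffices. -/
lemma strictMonoOn_sFun : StrictMonoOn sFun (Set.Ici 0) := by
  refine strictMonoOn_of_deriv_pos (convex_Ici 0) contDiffOn_sFun.continuousOn fun x hx => ?_
  rw [interior_Ici] at hx
  have hx : 0 < x := hx
  have h1 : HasDerivAt (fun x : ℝ => 1 + x) 1 x := (hasDerivAt_id x).const_add 1
  have h : HasDerivAt sFun (1 / (1 + x) - (1 * (1 + x) - x * 1) / (1 + x) ^ 2) x :=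
    (h1.log (by positivity)).sub ((hasDerivAt_id x).div h1 (by positivity))
  rw [h.deriv]
  have : 1 / (1 + x) - (1 * (1 + x) - x * 1) / (1 + x) ^ 2 = x / (1 + x) ^ 2 := by
    field_simp
    ring
  rw [this]
  positivity

lemma mapsTo_sFun : Set.MapsTo sFun (Set.Ici 0) (Set.Ici 0) := fun x hx => by
  have h := strictMonoOn_sFun.monotoneOn (Set.self_mem_Ici) hx hx
  rwa [sFun_zero] at h

end EntropyFunction

/-! ### Spectral integrals of multiplication operators -/

section Multiplication

variable {n : ℕ}

lemma memLp_top_of_norm_le {g : Config n → ℂ} (hg : Measurable g) {C : ℝ} (hC : ∀ q, ‖g q‖ ≤ C) :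
    MemLp g ∞ (volume : Measure (Config n)) :=
  memLp_top_of_bound hg.aestronglyMeasurable C (Filter.Eventually.of_forall hC)

lemma integrable_norm_sq (ψ : L2 n) : Integrable fun q => ‖ψ q‖ ^ 2 :=
  (Lp.memLp ψ).integrable_norm_pow two_ne_zero

/-- The Born rule: spectral integrals in the vector ψ become Lebesgue integrals weighted by |ψ|². -/
lemma diag_mulPVM {g : Config n → ℝ} (hg : Measurable g) (ψ : L2 n) :
    (mulPVM g hg).diag ψ =
      (volume.withDensity fun q => ENNReal.ofReal (‖ψ q‖ ^ 2)).map g := by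
  ext A hA
  rw [POVM.diag_apply _ _ hA, Measure.map_apply hg hA, withDensity_apply _ (hg hA),
    ← ofReal_integral_eq_lintegral_ofReal (integrable_norm_sq ψ).integrableOn
      (Filter.Eventually.of_forall fun q => by positivity)]
  congr 1
  have h : inner ℂ ψ ((mulPVM g hg).op A ψ) = ((∫ q in g ⁻¹' A, ‖ψ q‖ ^ 2 : ℝ) : ℂ) := by
    refine (inner_mulOp_indicator (hg hA) ψ ψ).trans ?_
    rw [← integral_complex_ofReal]
    refine integral_congr_ae (Filter.Eventually.of_forall fun q => ?_)
    simp [inner_self_eq_norm_sq_to_K]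
  rw [h, Complex.ofReal_re]

/-- Multiplication by `f ∘ g` is the integral of `f` with respect to the spectral measure of
multiplication by `g`. -/
lemma hasIntegral_mulPVM {g : Config n → ℝ} (hg : Measurable g) {f : ℝ → ℂ} (hf : Measurable f)
    {C : ℝ} (hC : ∀ t, ‖f t‖ ≤ C) :
    (mulPVM g hg).HasIntegral f (mulOp fun q => f (g q)) := by
  intro ψ
  have : IsFiniteMeasure (volume.withDensity fun q => ENNReal.ofReal (‖ψ q‖ ^ 2)) :=
    isFiniteMeasure_withDensity_ofReal (integrable_norm_sq ψ).2
  rw [diag_mulPVM]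
  refine ⟨(integrable_const C).mono' hf.aestronglyMeasurable (Filter.Eventually.of_forall hC), ?_⟩
  have hm : AEMeasurable (fun q => ENNReal.ofReal (‖ψ q‖ ^ 2)) :=
    (integrable_norm_sq ψ).aestronglyMeasurable.aemeasurable.ennreal_ofReal
  rw [integral_map hg.aemeasurable hf.aestronglyMeasurable,
    integral_withDensity_eq_integral_toReal_smul₀ hm (by simp), L2.inner_def]
  refine integral_congr_ae ?_
  filter_upwards [mulOp_ae (memLp_top_of_norm_le (hf.comp hg) fun q => hC (g q)) ψ] with q hq
  rw [Function.comp_def] at hq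
  rw [hq, ENNReal.toReal_ofReal (by positivity), RCLike.inner_apply', Complex.real_smul,
    mul_left_comm, ← Complex.normSq_eq_conj_mul_self, Complex.normSq_eq_norm_sq]
  ring

end Multiplication

/-! ### Isometry and commutation relations of the Weyl operators -/

section Weyl

variable {n : ℕ} {ħ : ℝ}

lemma weylL2_ae (ħ : ℝ) (x p : Config n) (ψ : L2 n) :
    weylL2 ħ x p ψ =ᵐ[volume] fun q =>
      Complex.exp (Complex.I * ((inner ℝ p q - inner ℝ p x / 2) / ħ : ℝ)) * ψ (q - x) := by
  have hm : MemLp (fun q => Complex.exp (Complex.I * ((inner ℝ p q - inner ℝ p x / 2) / ħ : ℝ))) ∞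
      (volume : Measure (Config n)) :=
    memLp_top_of_norm_le (by fun_prop) (C := 1) fun q => by
      rw [mul_comm, Complex.norm_exp_ofReal_mul_I]
  have h1 := mulOp_ae hm (Lp.compMeasurePreservingₗᵢ ℂ (fun q : Config n => q - x)
      (measurePreserving_sub_right volume x) ψ)
  have h2 := Lp.coeFn_compMeasurePreserving ψ (measurePreserving_sub_right volume x)
  filter_upwards [h1, h2] with q hq1 hq2
  refine hq1.trans ?_
  congr 1

/-- Lebesgue measure is translation invariant and the phase is unimodular. -/
lemma weylL2_inner_weylL2 (ħ : ℝ) (x p : Config n) (φ ψ : L2 n) :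
    inner ℂ (weylL2 ħ x p φ) (weylL2 ħ x p ψ) = inner ℂ φ ψ := by
  rw [L2.inner_def, L2.inner_def, ← integral_sub_right_eq_self (fun q => inner ℂ (φ q) (ψ q)) x]
  refine integral_congr_ae ?_
  filter_upwards [weylL2_ae ħ x p φ, weylL2_ae ħ x p ψ] with q h1 h2
  have he : ‖Complex.exp (Complex.I * ((inner ℝ p q - inner ℝ p x / 2) / ħ : ℝ))‖ = 1 := by
    rw [mul_comm, Complex.norm_exp_ofReal_mul_I]
  rw [h1, h2]
  generalize Complex.exp (Complex.I * ((inner ℝ p q - inner ℝ p x / 2) / ħ : ℝ)) = e at he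
  rw [← smul_eq_mul, ← smul_eq_mul, inner_smul_left, inner_smul_right, ← mul_assoc,
    Complex.conj_mul', he]
  simp

/-- The canonical commutation relations in Weyl form. -/
lemma weylL2_comm (ħ : ℝ) (x p y r : Config n) (ψ : L2 n) :
    weylL2 ħ x p (weylL2 ħ y r ψ) =
      Complex.exp (Complex.I * ((inner ℝ p y - inner ℝ r x) / ħ : ℝ)) •
        weylL2 ħ y r (weylL2 ħ x p ψ) := by
  refine Lp.ext ?_
  have h1 := (measurePreserving_sub_right (volume : Measure (Config n)) x).quasiMeasurePreserving.ae
    (weylL2_ae ħ y r ψ)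
  have h2 := (measurePreserving_sub_right (volume : Measure (Config n)) y).quasiMeasurePreserving.ae
    (weylL2_ae ħ x p ψ)
  filter_upwards [h1, h2, weylL2_ae ħ x p (weylL2 ħ y r ψ), weylL2_ae ħ y r (weylL2 ħ x p ψ),
    Lp.coeFn_smul (Complex.exp (Complex.I * ((inner ℝ p y - inner ℝ r x) / ħ : ℝ)))
      (weylL2 ħ y r (weylL2 ħ x p ψ))] with q h1 h2 h3 h4 h5
  rw [h3, h5, Pi.smul_apply, h4, h1, h2, smul_eq_mul, sub_right_comm q y x, ← mul_assoc,
    ← mul_assoc, ← mul_assoc, ← Complex.exp_add, ← Complex.exp_add, ← Complex.exp_add]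
  -- Both sides contain ψ(q-x-y) and the half-phases p·x/2 and r·y/2. The cross terms -r·x and -p·y
  -- differ, and their difference is the commutation phase.
  congr 2
  simp only [inner_sub_right]
  push_cast
  ring

variable {H : Type*} [NormedAddCommGroup H] [InnerProductSpace ℂ H] [CompleteSpace H]

lemma weyl_inner_weyl (ħ : ℝ) (U : H ≃ₗᵢ[ℂ] L2 n) (z : Fin n ⊕ Fin n → ℝ) (φ ψ : H) :
    inner ℂ (weyl ħ U z φ) (weyl ħ U z ψ) = inner ℂ φ ψ := by
  change inner ℂ (U.symm _) (U.symm _) = _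
  rw [U.symm.inner_map_map]
  exact (weylL2_inner_weylL2 ħ _ _ _ _).trans (U.inner_map_map _ _)

lemma weyl_comm (ħ : ℝ) (U : H ≃ₗᵢ[ℂ] L2 n) (x p y r : Fin n → ℝ) (ψ : H) :
    weyl ħ U (Sum.elim x p) (weyl ħ U (Sum.elim y r) ψ) =
      Complex.exp (Complex.I * ((p ⬝ᵥ y - r ⬝ᵥ x) / ħ : ℝ)) •
        weyl ħ U (Sum.elim y r) (weyl ħ U (Sum.elim x p) ψ) := by
  have h := congrArg U.symm (weylL2_comm ħ (WithLp.toLp 2 x) (WithLp.toLp 2 p) (WithLp.toLp 2 y)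
    (WithLp.toLp 2 r) (U ψ))
  rw [map_smul] at h
  simp only [EuclideanSpace.inner_toLp_toLp, star_trivial] at h
  rw [dotProduct_comm p, dotProduct_comm r]
  simpa [weyl] using h

end Weyl

/-! ### Exponentials of position and momentum as Weyl operators -/

section SharpObservables

open scoped FourierTransform SchwartzMap

variable {n : ℕ}

lemma norm_exp_I_mul_ofReal (r : ℝ) : ‖Complex.exp (Complex.I * r)‖ = 1 := by
  rw [mul_comm, Complex.norm_exp_ofReal_mul_I]

/-- The Fourier transform of a translated Schwartz function. -/
lemma fourier_compSubConstCLM (f : 𝓢(Config n, ℂ)) (x ξ : Config n) :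
    𝓕 (f.compSubConstCLM ℂ x) ξ =
      Complex.exp (Complex.I * (-(2 * Real.pi * inner ℝ x ξ) : ℝ)) * 𝓕 f ξ := by
  have h := congrFun (VectorFourier.fourierIntegral_comp_add_right Real.fourierChar volume
    (innerₗ (Config n)) f (-x)) ξ
  refine h.trans ?_
  rw [Circle.smul_def, Real.fourierChar_apply, smul_eq_mul, innerₗ_apply_apply, inner_neg_left,
    mul_comm Complex.I, mul_neg]
  rfl

/-- For zero momentum the phase is trivial, so Schwartz functions stay Schwartz and the classical
Fourier formula applies to them. -/
lemma weylL2_toLp (ħ : ℝ) (x : Config n) (f : 𝓢(Config n, ℂ)) :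
    weylL2 ħ x 0 (f.toLp 2) = (f.compSubConstCLM ℂ x).toLp 2 := by
  refine Lp.ext ?_
  have h1 := (measurePreserving_sub_right (volume : Measure (Config n)) x).quasiMeasurePreserving.ae
    (f.coeFn_toLp 2 volume)
  filter_upwards [weylL2_ae ħ x 0 (f.toLp 2), h1, (f.compSubConstCLM ℂ x).coeFn_toLp 2 volume]
    with q h2 h3 h4
  rw [h2, h3, h4]
  simp

/-- The Fourier transform turns translations into multiplication operators. -/
lemma fourierTransform_weylL2 (ħ : ℝ) (x : Config n) (ψ : L2 n) :
    Lp.fourierTransformₗᵢ (Config n) ℂ (weylL2 ħ x 0 ψ) =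
      mulOp (fun ξ => Complex.exp (Complex.I * (-(2 * Real.pi * inner ℝ x ξ) : ℝ)))
        (Lp.fourierTransformₗᵢ (Config n) ℂ ψ) := by
  -- Both sides are continuous in ψ, so it is enough to compare them on the dense set of Schwartz
  -- functions.
  have hd := SchwartzMap.denseRange_toLpCLM (E := Config n) (F := ℂ) (p := 2)
    (μ := volume) ENNReal.ofNat_ne_top
  refine congrFun (hd.equalizer
    (g := fun ψ => Lp.fourierTransformₗᵢ (Config n) ℂ (weylL2 ħ x 0 ψ))
    (h := fun ψ => mulOp (fun ξ => Complex.exp (Complex.I * (-(2 * Real.pi * inner ℝ x ξ) : ℝ)))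
      (Lp.fourierTransformₗᵢ (Config n) ℂ ψ)) (by fun_prop) (by fun_prop) (funext fun f => ?_)) ψ
  have h1 : ∀ g : 𝓢(Config n, ℂ), Lp.fourierTransformₗᵢ (Config n) ℂ (g.toLp 2) = (𝓕 g).toLp 2 :=
    SchwartzMap.toLp_fourier_eq
  simp only [Function.comp_apply, SchwartzMap.toLpCLM_apply]
  rw [weylL2_toLp, h1, h1]
  refine Lp.ext ?_
  have hm : MemLp (fun ξ => Complex.exp (Complex.I * (-(2 * Real.pi * inner ℝ x ξ) : ℝ))) ∞
      (volume : Measure (Config n)) :=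
    memLp_top_of_norm_le (by fun_prop) (C := 1) fun q => (norm_exp_I_mul_ofReal _).le
  filter_upwards [(𝓕 (f.compSubConstCLM ℂ x)).coeFn_toLp 2 volume, (𝓕 f).coeFn_toLp 2 volume,
    mulOp_ae hm ((𝓕 f).toLp 2)] with ξ h2 h3 h4
  rw [h2, h4, h3, fourier_compSubConstCLM]

lemma weylL2_zero_left {ħ : ℝ} (hħ : ħ ≠ 0) (t : ℝ) (u : Config n) :
    weylL2 ħ 0 (WithLp.toLp 2 (ħ • t • u.ofLp)) =
      mulOp fun q => Complex.exp (Complex.I * (t * inner ℝ u q : ℝ)) := by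
  refine ContinuousLinearMap.ext fun ψ => Lp.ext ?_
  have hm : MemLp (fun q => Complex.exp (Complex.I * (t * inner ℝ u q : ℝ))) ∞
      (volume : Measure (Config n)) :=
    memLp_top_of_norm_le (by fun_prop) (C := 1) fun q => (norm_exp_I_mul_ofReal _).le
  filter_upwards [weylL2_ae ħ 0 (WithLp.toLp 2 (ħ • t • u.ofLp)) ψ, mulOp_ae hm ψ] with q h1 h2
  have h3 : inner ℝ (WithLp.toLp 2 (ħ • t • u.ofLp)) q = ħ * (t * inner ℝ u q) := by
    change inner ℝ (ħ • t • u) q = _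
    rw [real_inner_smul_left, real_inner_smul_left]
  rw [h1, h2, h3, inner_zero_right, zero_div, sub_zero, sub_zero, mul_div_cancel_left₀ _ hħ]

/-- With this, W(-Ωw) for w = (a, b) is exp(i(a·Q + b·P)): the factor ħ cancels the 1/ħ in the Weyl
operator. -/
lemma neg_omega_mulVec (ħ : ℝ) (a b : Fin n → ℝ) :
    -((omega n ħ).mulVec (Sum.elim a b)) = Sum.elim (-(ħ • b)) (ħ • a) := by
  rw [omega, Matrix.fromBlocks_mulVec]
  funext i
  cases i <;> simp [Matrix.smul_mulVec, Matrix.neg_mulVec]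

variable {H : Type*} [NormedAddCommGroup H] [InnerProductSpace ℂ H] [CompleteSpace H]

/-- `exp (i t u·Q)` is a Weyl operator. -/
lemma hasIntegral_sharpQ {ħ : ℝ} (hħ : ħ ≠ 0) (U : H ≃ₗᵢ[ℂ] L2 n) (u : Config n) (t : ℝ) :
    (sharpQ U u).HasIntegral (fun s => Complex.exp (Complex.I * (t * s : ℝ)))
      (weyl ħ U (-((omega n ħ).mulVec (Sum.elim (t • u.ofLp) 0)))) := by
  have h := (hasIntegral_mulPVM (g := fun q => inner ℝ u q) (by fun_prop)
    (f := fun s => Complex.exp (Complex.I * (t * s : ℝ))) (by fun_prop) (C := 1)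
    fun s => (norm_exp_I_mul_ofReal _).le).conj U
  rw [← weylL2_zero_left hħ] at h
  rw [neg_omega_mulVec, smul_zero ħ, neg_zero]
  exact h

/-- `exp (i t v·P)` is a Weyl operator. -/
lemma hasIntegral_sharpP (ħ : ℝ) (U : H ≃ₗᵢ[ℂ] L2 n) (v : Config n) (t : ℝ) :
    (sharpP ħ U v).HasIntegral (fun s => Complex.exp (Complex.I * (t * s : ℝ)))
      (weyl ħ U (-((omega n ħ).mulVec (Sum.elim 0 (t • v.ofLp))))) := by
  have h := (hasIntegral_mulPVM (g := fun ξ => 2 * Real.pi * ħ * inner ℝ v ξ) (by fun_prop)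
    (f := fun s => Complex.exp (Complex.I * (t * s : ℝ))) (by fun_prop) (C := 1)
    fun s => (norm_exp_I_mul_ofReal _).le).conj (U.trans (Lp.fourierTransformₗᵢ (Config n) ℂ))
  rw [neg_omega_mulVec, smul_zero ħ]
  refine Eq.subst (motive := fun T => (sharpP ħ U v).HasIntegral _ T) ?_ h
  refine ContinuousLinearMap.ext fun ψ => ?_
  change U.symm ((Lp.fourierTransformₗᵢ (Config n) ℂ).symm (mulOp _
      (Lp.fourierTransformₗᵢ (Config n) ℂ (U ψ)))) =
    U.symm (weylL2 ħ (WithLp.toLp 2 (-(ħ • t • v.ofLp))) 0 (U ψ))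
  refine congrArg U.symm (Eq.symm ?_)
  -- Translation by -ħtv has Fourier multiplier exp(2πi ħt v·ξ), which is exp(i t ·) evaluated at
  -- the symbol 2πħ v·ξ of v·P.
  rw [LinearIsometryEquiv.eq_symm_apply, fourierTransform_weylL2]
  congr 2
  funext ξ
  have h3 : inner ℝ (WithLp.toLp 2 (-(ħ • t • v.ofLp))) ξ = -(ħ * (t * inner ℝ v ξ)) := by
    change inner ℝ (-(ħ • t • v)) ξ = _
    rw [inner_neg_left, real_inner_smul_left, real_inner_smul_left]
  rw [h3]
  congr 3
  ring

end SharpObservables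

/-! ### Covariance determines J -/

section Covariance

variable {n : ℕ} {ħ : ℝ}
  {H : Type*} [NormedAddCommGroup H] [InnerProductSpace ℂ H] [CompleteSpace H]
  {U : H ≃ₗᵢ[ℂ] L2 n} {u v : Config n} {M : POVM (Fin 2 → ℝ) H}

lemma adjoint_weyl_weyl (ħ : ℝ) (U : H ≃ₗᵢ[ℂ] L2 n) (z : Fin n ⊕ Fin n → ℝ) (ψ : H) :
    ContinuousLinearMap.adjoint (weyl ħ U z) (weyl ħ U z ψ) = ψ :=
  ext_inner_left ℂ fun φ => by
    rw [ContinuousLinearMap.adjoint_inner_right, weyl_inner_weyl]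

lemma IsCovariant.diag_weyl (h : IsCovariant ħ U u v M) (x p : Fin n → ℝ) (ψ : H) :
    M.diag (weyl ħ U (Sum.elim x p) ψ) =
      (M.diag ψ).map fun z => z + ![u.ofLp ⬝ᵥ x, v.ofLp ⬝ᵥ p] := by
  have hm : Measurable fun z : Fin 2 → ℝ => z + ![u.ofLp ⬝ᵥ x, v.ofLp ⬝ᵥ p] := by fun_prop
  ext A hA
  -- Covariance is applied to the preimage of A; by surjectivity of the translation its image is A
  -- itself.
  have hc := h x p _ (hm hA)
  rw [Set.image_preimage_eq _ (add_right_surjective _)] at hc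
  rw [M.diag_apply _ hA, Measure.map_apply hm hA, M.diag_apply _ (hm hA), ← hc]
  simp only [ContinuousLinearMap.comp_apply]
  rw [adjoint_weyl_weyl, weyl_inner_weyl]

/-- Differentiating at t = 0 removes the 2π ambiguity of a single phase. -/
lemma eq_of_forall_exp_eq {a b : ℝ}
    (h : ∀ t : ℝ, Complex.exp (Complex.I * (t * a : ℝ)) = Complex.exp (Complex.I * (t * b : ℝ))) :
    a = b := by
  have hd : ∀ c : ℝ, HasDerivAt (fun t : ℝ => Complex.exp (Complex.I * (t * c : ℝ)))
      (Complex.I * c) 0 := fun c => by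
    have h1 : HasDerivAt (fun t : ℝ => Complex.I * (t * c : ℝ)) (Complex.I * (1 * c : ℝ)) 0 :=
      (((hasDerivAt_id (0 : ℝ)).mul_const c).ofReal_comp).const_mul Complex.I
    simpa using h1.cexp
  have h2 := (hd a).unique ((hd b).congr_of_eventuallyEq (Filter.Eventually.of_forall h))
  exact Complex.ofReal_injective (mul_left_cancel₀ Complex.I_ne_zero h2)

/-- On the zero space every trace is 0, never 1. Nontriviality makes the Weyl operators nonzero. -/
lemma State.nontrivial (ρ : State H) : Nontrivial H := by
  by_contra h
  rw [not_nontrivial_iff_subsingleton] at h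
  have h1 := ρ.tr_eq_one
  simp [tr, Subsingleton.elim _ (0 : H)] at h1

lemma weyl_ne_zero [Nontrivial H] (ħ : ℝ) (U : H ≃ₗᵢ[ℂ] L2 n) (z : Fin n ⊕ Fin n → ℝ) :
    weyl ħ U z ≠ 0 := fun h => by
  obtain ⟨ψ, hψ⟩ := exists_ne (0 : H)
  have h1 := weyl_inner_weyl ħ U z ψ ψ
  rw [h] at h1
  exact hψ (by simpa using h1.symm)

/-- The expectation of W(y, r) in the displaced vector W(x, p)ψ is computed twice: the commutation
relations give the left phase, the translated outcome measure the right one. If the phases differed,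
⟨ψ, W(y, r)ψ⟩ would vanish for every ψ, and over ℂ this forces W(y, r) = 0. -/
lemma IsCovariant.exp_eq_exp [Nontrivial H] (h : IsCovariant ħ U u v M) {k : Fin 2 → ℝ}
    {y r : Fin n → ℝ} {γ : ℂ} (hγ : γ ≠ 0)
    (hI : M.HasIntegral (fun z => Complex.exp (Complex.I * (k ⬝ᵥ z : ℝ)))
      (γ • weyl ħ U (Sum.elim y r))) (x p : Fin n → ℝ) :
    Complex.exp (Complex.I * ((r ⬝ᵥ x - p ⬝ᵥ y) / ħ : ℝ)) =
      Complex.exp (Complex.I * (k 0 * u.ofLp ⬝ᵥ x + k 1 * v.ofLp ⬝ᵥ p : ℝ)) := by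
  by_contra hne
  refine weyl_ne_zero ħ U (Sum.elim y r) (ContinuousLinearMap.coe_injective ?_)
  refine inner_map_self_eq_zero _ |>.1 fun ψ => ?_
  have h1 := (hI (weyl ħ U (Sum.elim x p) ψ)).2
  have hm : Measurable fun z : Fin 2 → ℝ => z + ![u.ofLp ⬝ᵥ x, v.ofLp ⬝ᵥ p] := by fun_prop
  have hm' : Measurable fun z : Fin 2 → ℝ => Complex.exp (Complex.I * (k ⬝ᵥ z : ℝ)) := by
    unfold dotProduct
    fun_prop
  have h2 : ∀ z : Fin 2 → ℝ,
      Complex.exp (Complex.I * (k ⬝ᵥ (z + ![u.ofLp ⬝ᵥ x, v.ofLp ⬝ᵥ p]) : ℝ)) =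
      Complex.exp (Complex.I * (k 0 * u.ofLp ⬝ᵥ x + k 1 * v.ofLp ⬝ᵥ p : ℝ)) *
        Complex.exp (Complex.I * (k ⬝ᵥ z : ℝ)) := fun z => by
    rw [← Complex.exp_add, dotProduct_add]
    congr 1
    simp [dotProduct, Fin.sum_univ_two]
    ring
  rw [h.diag_weyl, integral_map hm.aemeasurable hm'.aestronglyMeasurable] at h1
  simp only [h2] at h1
  rw [integral_const_mul, (hI ψ).2, smul_apply, smul_apply,
    weyl_comm, inner_smul_right, inner_smul_right, inner_smul_right, weyl_inner_weyl] at h1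
  have h3 : (Complex.exp (Complex.I * ((r ⬝ᵥ x - p ⬝ᵥ y) / ħ : ℝ)) -
      Complex.exp (Complex.I * (k 0 * u.ofLp ⬝ᵥ x + k 1 * v.ofLp ⬝ᵥ p : ℝ))) *
        inner ℂ ψ (weyl ħ U (Sum.elim y r) ψ) = 0 :=
    mul_left_cancel₀ hγ (by linear_combination -h1)
  have h4 := (mul_eq_zero.1 h3).resolve_left (sub_ne_zero.2 hne)
  rw [← inner_conj_symm]
  exact (congrArg _ h4).trans (map_zero _)

/-- Covariance determines the matrix `J` of a Gaussian observable. -/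
lemma IsCovariant.transpose_mulVec_eq [Nontrivial H] (hħ : ħ ≠ 0) (h : IsCovariant ħ U u v M)
    {μ : Fin 2 → ℝ} {V : Matrix (Fin 2) (Fin 2) ℝ} {J : Matrix (Fin 2) (Fin n ⊕ Fin n) ℝ}
    (hM : IsGaussianObservable ħ U M μ V J) (k : Fin 2 → ℝ) :
    J.transpose.mulVec k = Sum.elim (k 0 • u.ofLp) (k 1 • v.ofLp) := by
  obtain ⟨a, b, hab⟩ : ∃ a b : Fin n → ℝ, J.transpose.mulVec k = Sum.elim a b :=
    ⟨_, _, (Sum.elim_comp_inl_inr _).symm⟩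
  have hI := hM.2.2 k
  rw [hab, neg_omega_mulVec] at hI
  have h1 : ∀ x p : Fin n → ℝ,
      a ⬝ᵥ x + b ⬝ᵥ p = k 0 * u.ofLp ⬝ᵥ x + k 1 * v.ofLp ⬝ᵥ p := fun x p => by
    -- Only phases are known to agree; scaling (x, p) by every real t yields equality of the
    -- exponents.
    refine eq_of_forall_exp_eq fun t => ?_
    have h2 := h.exp_eq_exp (Complex.exp_ne_zero _) hI (t • x) (t • p)
    convert h2 using 3
    · rw [smul_dotProduct, dotProduct_smul, dotProduct_neg, dotProduct_smul, smul_dotProduct,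
        dotProduct_comm p b]
      simp only [smul_eq_mul]
      congr 1
      field_simp
      ring
    · simp only [dotProduct_smul, smul_eq_mul]
      congr 1
      ring
  rw [hab]
  congr 1
  · refine dotProduct_eq _ _ fun x => ?_
    simpa using h1 x 0
  · refine dotProduct_eq _ _ fun p => ?_
    simpa using h1 0 p

end Covariance

/-! ### Uncertainty relation and strict positivity of the variances -/

section Positivity

/-- Testing on s + it makes the symplectic part visible in the real part, since i/2 meets another
factor i in the mixed terms. -/
lemma re_dotProduct_mulVec {ι : Type*} [Fintype ι] (V W : Matrix ι ι ℝ) (s t : ι → ℝ) :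
    (star (fun i => (s i + t i * Complex.I : ℂ)) ⬝ᵥ
      (V.map Complex.ofReal + (Complex.I / 2) • W.map Complex.ofReal).mulVec
        fun i => (s i + t i * Complex.I : ℂ)).re =
      s ⬝ᵥ V.mulVec s + t ⬝ᵥ V.mulVec t - (s ⬝ᵥ W.mulVec t - t ⬝ᵥ W.mulVec s) / 2 := by
  simp only [dotProduct, Matrix.mulVec, Finset.mul_sum, Complex.re_sum, ← Finset.sum_add_distrib,
    ← Finset.sum_sub_distrib, Finset.sum_div]
  refine Finset.sum_congr rfl fun i _ => Finset.sum_congr rfl fun j _ => ?_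
  simp
  ring

variable {n : ℕ} {ħ : ℝ}

lemma elim_dotProduct_mulVec_left (V : Matrix (Fin n ⊕ Fin n) (Fin n ⊕ Fin n) ℝ) (t : ℝ)
    (u : Fin n → ℝ) :
    Sum.elim (t • u) 0 ⬝ᵥ V.mulVec (Sum.elim (t • u) 0) =
      t ^ 2 * u ⬝ᵥ V.toBlocks₁₁.mulVec u := by
  rw [← Matrix.fromBlocks_toBlocks V, Matrix.fromBlocks_mulVec]
  simp [Matrix.mulVec_smul]
  ring

lemma elim_dotProduct_mulVec_right (V : Matrix (Fin n ⊕ Fin n) (Fin n ⊕ Fin n) ℝ) (t : ℝ)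
    (v : Fin n → ℝ) :
    Sum.elim 0 (t • v) ⬝ᵥ V.mulVec (Sum.elim 0 (t • v)) =
      t ^ 2 * v ⬝ᵥ V.toBlocks₂₂.mulVec v := by
  rw [← Matrix.fromBlocks_toBlocks V, Matrix.fromBlocks_mulVec]
  simp [Matrix.mulVec_smul]
  ring

/-- The uncertainty relation for the position and momentum covariances along a unit vector. -/
lemma mul_le_of_posSemidef {V : Matrix (Fin n ⊕ Fin n) (Fin n ⊕ Fin n) ℝ}
    (hV : (V.map Complex.ofReal + (Complex.I / 2) • (omega n ħ).map Complex.ofReal).PosSemidef)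
    {u : Config n} (hu : ‖u‖ = 1) (a b : ℝ) :
    a * b * ħ ≤ a ^ 2 * u.ofLp ⬝ᵥ V.toBlocks₁₁.mulVec u.ofLp +
      b ^ 2 * u.ofLp ⬝ᵥ V.toBlocks₂₂.mulVec u.ofLp := by
  -- The test vector is (au, ibu); its mixed position-momentum entries of V drop out of the real
  -- part, and Ω contributes -abħ because u is a unit vector.
  have h := (Complex.le_def.1 (hV.dotProduct_mulVec_nonneg fun i =>
    ((Sum.elim (a • u.ofLp) 0 : Fin n ⊕ Fin n → ℝ) i +
      (Sum.elim 0 (b • u.ofLp) : Fin n ⊕ Fin n → ℝ) i * Complex.I : ℂ))).1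
  have huu : u.ofLp ⬝ᵥ u.ofLp = 1 := by
    have h1 : inner ℝ u u = (1 : ℝ) := by rw [real_inner_self_eq_norm_sq, hu, one_pow]
    rwa [EuclideanSpace.inner_eq_star_dotProduct, star_trivial] at h1
  rw [re_dotProduct_mulVec, elim_dotProduct_mulVec_left, elim_dotProduct_mulVec_right,
    ← neg_neg ((omega n ħ).mulVec _), neg_omega_mulVec, ← neg_neg ((omega n ħ).mulVec _),
    neg_omega_mulVec] at h
  simp [huu] at h
  linarith

lemma pos_of_forall_mul_le {α β : ℝ} (hħ : 0 < ħ)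
    (h : ∀ a b : ℝ, a * b * ħ ≤ a ^ 2 * α + b ^ 2 * β) : 0 < α := by
  by_contra hα
  -- The left side becomes |β| + 1, whereas α ≤ 0 would bound the right side by β.
  have h1 := h ((|β| + 1) / ħ) 1
  have h2 : (|β| + 1) / ħ * 1 * ħ = |β| + 1 := by field_simp
  nlinarith [le_abs_self β, sq_nonneg ((|β| + 1) / ħ)]

end Positivity

/-! ### Gaussian distributions of the observables and the error function -/

section Gaussian

variable {n : ℕ} {ħ : ℝ}
  {H : Type*} [NormedAddCommGroup H] [InnerProductSpace ℂ H] [CompleteSpace H]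
  {U : H ≃ₗᵢ[ℂ] L2 n} {u v : Config n} {M : POVM (Fin 2 → ℝ) H} {ρ : State H}
  {μρ : Fin n ⊕ Fin n → ℝ} {Vρ : Matrix (Fin n ⊕ Fin n) (Fin n ⊕ Fin n) ℝ}
  {μM : Fin 2 → ℝ} {VM : Matrix (Fin 2) (Fin 2) ℝ} {JM : Matrix (Fin 2) (Fin n ⊕ Fin n) ℝ}

lemma tr_comp_smul (S T : H →L[ℂ] H) (c : ℂ) : tr (S ∘L (c • T)) = c * tr (S ∘L T) := by
  simp [tr, tsum_mul_left]

/-- An observable whose characteristic function in the state `ρ` is Gaussian has a Gaussian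
distribution in the state `ρ`. -/
lemma POVM.dist_eq_gaussianReal {E : POVM ℝ H} {T : ℝ → H →L[ℂ] H} {m c : ℝ} (hc : 0 ≤ c)
    (hT : ∀ t, E.HasIntegral (fun s => Complex.exp (Complex.I * (t * s : ℝ))) (T t))
    (htr : ∀ t : ℝ, tr (ρ.op ∘L T t) =
      Complex.exp (Complex.I * (t * m : ℝ) - (t ^ 2 * c / 2 : ℝ))) :
    E.dist ρ = gaussianReal m c.toNNReal := by
  refine Measure.ext_of_charFun (funext fun t => ?_)
  have hi : Integrable (fun s : ℝ => Complex.exp (Complex.I * (t * s : ℝ))) (E.dist ρ) :=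
    (integrable_const (1 : ℝ)).mono' (by fun_prop)
      (Filter.Eventually.of_forall fun s => (norm_exp_I_mul_ofReal _).le)
  have h := (hT t).integral_dist hi
  rw [htr] at h
  rw [charFun_apply_real, charFun_gaussianReal, Real.coe_toNNReal _ hc]
  convert h using 2
  · funext s
    congr 1
    push_cast
    ring
  · push_cast
    ring

lemma IsGaussianState.position_variance_pos (hħ : 0 < ħ) (hu : ‖u‖ = 1)
    (hρ : IsGaussianState ħ U ρ μρ Vρ) : 0 < u.ofLp ⬝ᵥ Vρ.toBlocks₁₁.mulVec u.ofLp :=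
  pos_of_forall_mul_le hħ fun a b => mul_le_of_posSemidef hρ.1 hu a b

lemma IsGaussianState.momentum_variance_pos (hħ : 0 < ħ) (hv : ‖v‖ = 1)
    (hρ : IsGaussianState ħ U ρ μρ Vρ) : 0 < v.ofLp ⬝ᵥ Vρ.toBlocks₂₂.mulVec v.ofLp := by
  -- Exchanging a and b in the uncertainty relation puts the momentum form in the role of α.
  refine pos_of_forall_mul_le (β := v.ofLp ⬝ᵥ Vρ.toBlocks₁₁.mulVec v.ofLp) hħ fun a b => ?_
  rw [mul_comm a b, add_comm]
  exact mul_le_of_posSemidef hρ.1 hv b a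

lemma IsGaussianState.tr_left (hρ : IsGaussianState ħ U ρ μρ Vρ) (t : ℝ) :
    tr (ρ.op ∘L weyl ħ U (-((omega n ħ).mulVec (Sum.elim (t • u.ofLp) 0)))) =
      Complex.exp (Complex.I * (t * (u.ofLp ⬝ᵥ (μρ ∘ Sum.inl)) : ℝ) -
        (t ^ 2 * (u.ofLp ⬝ᵥ Vρ.toBlocks₁₁.mulVec u.ofLp) / 2 : ℝ)) := by
  have h : Sum.elim (t • u.ofLp) 0 ⬝ᵥ μρ = t * (u.ofLp ⬝ᵥ (μρ ∘ Sum.inl)) := by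
    conv_lhs => rw [← Sum.elim_comp_inl_inr μρ, sumElim_dotProduct_sumElim]
    simp
  exact (hρ.2 _).trans (by rw [elim_dotProduct_mulVec_left, h])

lemma IsGaussianState.tr_right (hρ : IsGaussianState ħ U ρ μρ Vρ) (t : ℝ) :
    tr (ρ.op ∘L weyl ħ U (-((omega n ħ).mulVec (Sum.elim 0 (t • v.ofLp))))) =
      Complex.exp (Complex.I * (t * (v.ofLp ⬝ᵥ (μρ ∘ Sum.inr)) : ℝ) -
        (t ^ 2 * (v.ofLp ⬝ᵥ Vρ.toBlocks₂₂.mulVec v.ofLp) / 2 : ℝ)) := by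
  have h : Sum.elim 0 (t • v.ofLp) ⬝ᵥ μρ = t * (v.ofLp ⬝ᵥ (μρ ∘ Sum.inr)) := by
    conv_lhs => rw [← Sum.elim_comp_inl_inr μρ, sumElim_dotProduct_sumElim]
    simp
  exact (hρ.2 _).trans (by rw [elim_dotProduct_mulVec_right, h])

lemma dist_sharpQ (hħ : 0 < ħ) (hu : ‖u‖ = 1) (hρ : IsGaussianState ħ U ρ μρ Vρ) :
    (sharpQ U u).dist ρ = gaussianReal (u.ofLp ⬝ᵥ (μρ ∘ Sum.inl))
      (u.ofLp ⬝ᵥ Vρ.toBlocks₁₁.mulVec u.ofLp).toNNReal :=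
  POVM.dist_eq_gaussianReal (hρ.position_variance_pos hħ hu).le (hasIntegral_sharpQ hħ.ne' U u)
    hρ.tr_left

lemma dist_sharpP (hħ : 0 < ħ) (hv : ‖v‖ = 1) (hρ : IsGaussianState ħ U ρ μρ Vρ) :
    (sharpP ħ U v).dist ρ = gaussianReal (v.ofLp ⬝ᵥ (μρ ∘ Sum.inr))
      (v.ofLp ⬝ᵥ Vρ.toBlocks₂₂.mulVec v.ofLp).toNNReal :=
  POVM.dist_eq_gaussianReal (hρ.momentum_variance_pos hħ hv).le (hasIntegral_sharpP ħ U v)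
    hρ.tr_right

/-- The matrix (i/2) JΩJᵀ has purely imaginary entries, so the real part of each diagonal entry is
that of V alone. -/
lemma IsGaussianObservable.diag_nonneg (hM : IsGaussianObservable ħ U M μM VM JM) (i : Fin 2) :
    0 ≤ VM i i := by
  have h1 := (Complex.le_def.1 (hM.1.diag_nonneg (i := i))).1
  have h2 := (Complex.le_def.1 (hM.2.1.diag_nonneg (i := i))).1
  simp at h1 h2
  linarith

/-- On the coordinate axis k = (t, 0) the off-diagonal entries of V do not enter, which is why they
cannot affect the marginal. -/
lemma IsGaussianObservable.hasIntegral_marginal₁ (hM : IsGaussianObservable ħ U M μM VM JM)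
    (t : ℝ) : (marginal₁ M).HasIntegral (fun s => Complex.exp (Complex.I * (t * s : ℝ)))
      (Complex.exp (Complex.I * (t * μM 0 : ℝ) - (t ^ 2 * VM 0 0 / 2 : ℝ)) •
        weyl ħ U (-((omega n ħ).mulVec (JM.transpose.mulVec ![t, 0])))) := by
  refine POVM.HasIntegral.map _ (by fun_prop) ?_
  have h := hM.2.2 ![t, 0]
  simp only [dotProduct, Matrix.mulVec, Fin.sum_univ_two, Matrix.cons_val_zero,
    Matrix.cons_val_one, zero_mul, mul_zero, add_zero] at h ⊢
  rwa [show t * (VM 0 0 * t) = t ^ 2 * VM 0 0 by ring] at h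

lemma IsGaussianObservable.hasIntegral_marginal₂ (hM : IsGaussianObservable ħ U M μM VM JM)
    (t : ℝ) : (marginal₂ M).HasIntegral (fun s => Complex.exp (Complex.I * (t * s : ℝ)))
      (Complex.exp (Complex.I * (t * μM 1 : ℝ) - (t ^ 2 * VM 1 1 / 2 : ℝ)) •
        weyl ħ U (-((omega n ħ).mulVec (JM.transpose.mulVec ![0, t])))) := by
  refine POVM.HasIntegral.map _ (by fun_prop) ?_
  have h := hM.2.2 ![0, t]
  simp only [dotProduct, Matrix.mulVec, Fin.sum_univ_two, Matrix.cons_val_zero,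
    Matrix.cons_val_one, zero_mul, mul_zero, zero_add] at h ⊢
  rwa [show t * (VM 1 1 * t) = t ^ 2 * VM 1 1 by ring] at h

/-- Since Jᵀ(t, 0) = (tu, 0), the Weyl operator here is exp(i t u·Q); the exponents of noise and
state add up. -/
lemma dist_marginal₁ (hħ : 0 < ħ) (hu : ‖u‖ = 1) (hρ : IsGaussianState ħ U ρ μρ Vρ)
    (hc : IsCovariant ħ U u v M) (hM : IsGaussianObservable ħ U M μM VM JM) :
    (marginal₁ M).dist ρ = gaussianReal (u.ofLp ⬝ᵥ (μρ ∘ Sum.inl) + μM 0)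
      (u.ofLp ⬝ᵥ Vρ.toBlocks₁₁.mulVec u.ofLp + VM 0 0).toNNReal := by
  have := ρ.nontrivial
  refine POVM.dist_eq_gaussianReal
    (add_nonneg (hρ.position_variance_pos hħ hu).le (hM.diag_nonneg 0))
    hM.hasIntegral_marginal₁ fun t => ?_
  rw [hc.transpose_mulVec_eq hħ.ne' hM, tr_comp_smul]
  simp only [Matrix.cons_val_zero, Matrix.cons_val_one, zero_smul]
  rw [hρ.tr_left, ← Complex.exp_add]
  congr 1
  push_cast
  ring

lemma dist_marginal₂ (hħ : 0 < ħ) (hv : ‖v‖ = 1) (hρ : IsGaussianState ħ U ρ μρ Vρ)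
    (hc : IsCovariant ħ U u v M) (hM : IsGaussianObservable ħ U M μM VM JM) :
    (marginal₂ M).dist ρ = gaussianReal (v.ofLp ⬝ᵥ (μρ ∘ Sum.inr) + μM 1)
      (v.ofLp ⬝ᵥ Vρ.toBlocks₂₂.mulVec v.ofLp + VM 1 1).toNNReal := by
  have := ρ.nontrivial
  refine POVM.dist_eq_gaussianReal
    (add_nonneg (hρ.momentum_variance_pos hħ hv).le (hM.diag_nonneg 1))
    hM.hasIntegral_marginal₂ fun t => ?_
  rw [hc.transpose_mulVec_eq hħ.ne' hM, tr_comp_smul]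
  simp only [Matrix.cons_val_zero, Matrix.cons_val_one, zero_smul]
  rw [hρ.tr_right, ← Complex.exp_add]
  congr 1
  push_cast
  ring

/-- The error function in terms of the covariances. -/
lemma errorFunction_gaussian (hħ : 0 < ħ) (hu : ‖u‖ = 1) (hv : ‖v‖ = 1)
    (hρ : IsGaussianState ħ U ρ μρ Vρ) (hc : IsCovariant ħ U u v M)
    (hM : IsGaussianObservable ħ U M μM VM JM) :
    errorFunction ħ U u v ρ M ≠ ∞ ∧
    (errorFunction ħ U u v ρ M).toReal = Real.logb 2 (Real.exp 1) / 2 *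
      (sFun (VM 0 0 / (u.ofLp ⬝ᵥ Vρ.toBlocks₁₁.mulVec u.ofLp)) +
        sFun (VM 1 1 / (v.ofLp ⬝ᵥ Vρ.toBlocks₂₂.mulVec v.ofLp)) +
        (μM 0 ^ 2 / (u.ofLp ⬝ᵥ Vρ.toBlocks₁₁.mulVec u.ofLp + VM 0 0) +
          μM 1 ^ 2 / (v.ofLp ⬝ᵥ Vρ.toBlocks₂₂.mulVec v.ofLp + VM 1 1))) := by
  obtain ⟨hQ, hQ'⟩ := relEntropy_gaussianReal (u.ofLp ⬝ᵥ (μρ ∘ Sum.inl)) (μM 0)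
    (hρ.position_variance_pos hħ hu) (hM.diag_nonneg 0)
  obtain ⟨hP, hP'⟩ := relEntropy_gaussianReal (v.ofLp ⬝ᵥ (μρ ∘ Sum.inr)) (μM 1)
    (hρ.momentum_variance_pos hħ hv) (hM.diag_nonneg 1)
  rw [errorFunction, dist_sharpQ hħ hu hρ, dist_sharpP hħ hv hρ, dist_marginal₁ hħ hu hρ hc hM,
    dist_marginal₂ hħ hv hρ hc hM]
  refine ⟨ENNReal.add_ne_top.2 ⟨hQ, hP⟩, ?_⟩
  rw [ENNReal.toReal_add hQ hP, hQ', hP']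
  ring

end Gaussian

end EntropicMUR

end

theorem mainTheorem7 {n : ℕ} {ħ : ℝ} (hħ : 0 < ħ)
    {H : Type*} [NormedAddCommGroup H] [InnerProductSpace ℂ H] [CompleteSpace H]
    (U : H ≃ₗᵢ[ℂ] EntropicMUR.L2 n)
    (u v : EntropicMUR.Config n) (hu : ‖u‖ = 1) (hv : ‖v‖ = 1) :
    -- the properties of `s` on `[0, ∞)`
    (Set.MapsTo EntropicMUR.sFun (Set.Ici 0) (Set.Ici 0) ∧
      ContDiffOn ℝ ((⊤ : ℕ∞) : WithTop ℕ∞) EntropicMUR.sFun (Set.Ici 0) ∧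
      StrictMonoOn EntropicMUR.sFun (Set.Ici 0) ∧
      EntropicMUR.sFun 0 = 0) ∧
    -- the formula for the error function, for `ρ` Gaussian with parameters `(μρ, Vρ)`
    -- and `M` Gaussian and covariant with parameters `(μM, VM, JM)`
    (∀ (ρ : EntropicMUR.State H) (μρ : Fin n ⊕ Fin n → ℝ)
        (Vρ : Matrix (Fin n ⊕ Fin n) (Fin n ⊕ Fin n) ℝ)
        (M : EntropicMUR.POVM (Fin 2 → ℝ) H) (μM : Fin 2 → ℝ) (VM : Matrix (Fin 2) (Fin 2) ℝ)
        (JM : Matrix (Fin 2) (Fin n ⊕ Fin n) ℝ),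
      EntropicMUR.IsGaussianState ħ U ρ μρ Vρ →
      EntropicMUR.IsCovariant ħ U u v M →
      EntropicMUR.IsGaussianObservable ħ U M μM VM JM →
      ∀ varQ varP varM₁ varM₂ x y Δ : ℝ,
        varQ = Var[id; (EntropicMUR.sharpQ U u).dist ρ] →
        varP = Var[id; (EntropicMUR.sharpP ħ U v).dist ρ] →
        varM₁ = Var[id; (EntropicMUR.marginal₁ M).dist ρ] →
        varM₂ = Var[id; (EntropicMUR.marginal₂ M).dist ρ] →
        x = VM 0 0 / varQ →
        y = VM 1 1 / varP →
        Δ = μM 0 ^ 2 / varM₁ + μM 1 ^ 2 / varM₂ →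
        varQ = u.ofLp ⬝ᵥ Vρ.toBlocks₁₁.mulVec u.ofLp ∧
        varP = v.ofLp ⬝ᵥ Vρ.toBlocks₂₂.mulVec v.ofLp ∧
        varM₁ = varQ + VM 0 0 ∧
        varM₂ = varP + VM 1 1 ∧
        0 < varQ ∧ 0 < varP ∧ 0 ≤ x ∧ 0 ≤ y ∧
        EntropicMUR.errorFunction ħ U u v ρ M ≠ ∞ ∧
        (EntropicMUR.errorFunction ħ U u v ρ M).toReal =
          Real.logb 2 (Real.exp 1) / 2 * (EntropicMUR.sFun x + EntropicMUR.sFun y + Δ)) ∧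
    -- the error function does not depend on the mixed covariances
    (∀ (ρ ρ' : EntropicMUR.State H) (μρ μρ' : Fin n ⊕ Fin n → ℝ)
        (Vρ Vρ' : Matrix (Fin n ⊕ Fin n) (Fin n ⊕ Fin n) ℝ)
        (M M' : EntropicMUR.POVM (Fin 2 → ℝ) H) (μM μM' : Fin 2 → ℝ)
        (VM VM' : Matrix (Fin 2) (Fin 2) ℝ) (JM JM' : Matrix (Fin 2) (Fin n ⊕ Fin n) ℝ),
      EntropicMUR.IsGaussianState ħ U ρ μρ Vρ →
      EntropicMUR.IsGaussianState ħ U ρ' μρ' Vρ' →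
      EntropicMUR.IsCovariant ħ U u v M →
      EntropicMUR.IsCovariant ħ U u v M' →
      EntropicMUR.IsGaussianObservable ħ U M μM VM JM →
      EntropicMUR.IsGaussianObservable ħ U M' μM' VM' JM' →
      Vρ.toBlocks₁₁ = Vρ'.toBlocks₁₁ → Vρ.toBlocks₂₂ = Vρ'.toBlocks₂₂ →
      VM 0 0 = VM' 0 0 → VM 1 1 = VM' 1 1 → μM = μM' →
      EntropicMUR.errorFunction ħ U u v ρ M = EntropicMUR.errorFunction ħ U u v ρ' M') := by
  refine ⟨⟨EntropicMUR.mapsTo_sFun, EntropicMUR.contDiffOn_sFun, EntropicMUR.strictMonoOn_sFun,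
    EntropicMUR.sFun_zero⟩, ?_, ?_⟩
  · intro ρ μρ Vρ M μM VM JM hρ hc hM varQ varP varM₁ varM₂ x y Δ hvQ hvP hvM₁ hvM₂ hx hy hΔ
    have hQ := hρ.position_variance_pos hħ hu
    have hP := hρ.momentum_variance_pos hħ hv
    have h0 := hM.diag_nonneg 0
    have h1 := hM.diag_nonneg 1
    rw [EntropicMUR.dist_sharpQ hħ hu hρ, variance_id_gaussianReal,
      Real.coe_toNNReal _ hQ.le] at hvQ
    rw [EntropicMUR.dist_sharpP hħ hv hρ, variance_id_gaussianReal,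
      Real.coe_toNNReal _ hP.le] at hvP
    rw [EntropicMUR.dist_marginal₁ hħ hu hρ hc hM, variance_id_gaussianReal,
      Real.coe_toNNReal _ (by positivity), ← hvQ] at hvM₁
    rw [EntropicMUR.dist_marginal₂ hħ hv hρ hc hM, variance_id_gaussianReal,
      Real.coe_toNNReal _ (by positivity), ← hvP] at hvM₂
    have h := EntropicMUR.errorFunction_gaussian hħ hu hv hρ hc hM
    rw [← hvQ, ← hvP, ← hvM₁, ← hvM₂, ← hx, ← hy, ← hΔ] at h
    rw [← hvQ] at hQ
    rw [← hvP] at hP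
    exact ⟨hvQ, hvP, hvM₁, hvM₂, hQ, hP, hx ▸ div_nonneg h0 hQ.le, hy ▸ div_nonneg h1 hP.le, h⟩
  · intro ρ ρ' μρ μρ' Vρ Vρ' M M' μM μM' VM VM' JM JM' hρ hρ' hc hc' hM hM' hA hB h0 h1 hμ
    have h := EntropicMUR.errorFunction_gaussian hħ hu hv hρ hc hM
    have h' := EntropicMUR.errorFunction_gaussian hħ hu hv hρ' hc' hM'
    -- Finiteness of both values reduces the equality in `ℝ≥0∞` to that of the real formulas.
    rw [← ENNReal.toReal_eq_toReal_iff' h.1 h'.1, h.2, h'.2, hA, hB, h0, h1, hμ]
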